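/- For a Lebesgue measurable set $A\subset\mathbb{R}^d$ let $P(A)=\sup\{\int_A \operatorname{div}T\,dx:\ T\in C^1_c(\mathbb{R}^d;\mathbb{R}^d),\ |T|\le 1\}$ be its De Giorgi perimeter. A measurable set $\Omega\subset\mathbb{R}^d$ is called a perimeter supersolution if $|\Omega|<\infty$, $P(\Omega)<\infty$ and $P(\Omega)\le P(\widetilde\Omega)$ for every measurable $\widetilde\Omega\supset\Omega$ with $|\widetilde\Omega|<\infty$. Let $\widetilde H^1_0(\Omega)=\{u\in H^1(\mathbb{R}^d):\ u=0 \text{ a.e. on } \Omega^c\}$, and let the torsion (energy) function $w_\Omega\in\widetilde H^1_0(\Omega)$ be the weak solution of $-\Delta w_\Omega=1$ in this space, i.e. $\int_{\mathbb{R}^d}\nabla w_\Omega\cdot\nabla v\,dx=\int_{\mathbb{R}^d} v\,dx$ for every $v\in\widetilde H^1_0(\Omega)$. **Proposition.** If the open set $\Omega\subset\mathbb{R}^d$ is a perimeter supersolution, then $w_\Omega$ is Lipschitz continuous on $\mathbb{R}^d$: it coincides almost everywhere with a Lipschitz function $W:\mathbb{R}^d\to\mathbb{R}$, and $W(x)=0$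 at every point $x$ such that $|B_r(x)\setminus\Omega|>0$ for all $r>0$. In particular, if every point of $\Omega^c$ has this property (that is, if $\Omega$ contains every point $x$ for which some ball $B_r(x)$ is contained in $\Omega$ up to a null set), then $W=0$ everywhere on $\Omega^c$. -/

import Mathlib

open MeasureTheory
open scoped ENNReal NNReal ContDiff

noncomputable section

/-- The divergence `∑ i, ∂ᵢ Tᵢ` of a vector field on `ℝ^d`. -/
def divergence {d : ℕ} (T : EuclideanSpace ℝ (Fin d) → EuclideanSpace ℝ (Fin d))
    (x : EuclideanSpace ℝ (Fin d)) : ℝ :=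
  ∑ i : Fin d, (fderiv ℝ T x (EuclideanSpace.single i 1)) i

/-- The De Giorgi perimeter `P(A) = sup {∫_A div T : T ∈ C¹_c(ℝ^d; ℝ^d), |T| ≤ 1}`. The supremum is
nonnegative because of `T = 0`, so cutting negative values off at `0` does not change it. -/
def perimeter {d : ℕ} (A : Set (EuclideanSpace ℝ (Fin d))) : ℝ≥0∞ :=
  ⨆ (T : EuclideanSpace ℝ (Fin d) → EuclideanSpace ℝ (Fin d)) (_ : ContDiff ℝ 1 T)
    (_ : HasCompactSupport T) (_ : ∀ x, ‖T x‖ ≤ 1), ENNReal.ofReal (∫ x in A, divergence T x)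

/-- A perimeter supersolution: a Lebesgue measurable set of finite measure and finite perimeter
whose perimeter is at most that of every measurable superset of finite measure. (Without finite
measure of the superset, `ℝ^d`, of perimeter `0`, would be a competitor and only null sets would
qualify.) -/
structure IsPerimeterSupersolution {d : ℕ} (Ω : Set (EuclideanSpace ℝ (Fin d))) : Prop where
  nullMeasurableSet : NullMeasurableSet Ω volume
  volume_lt_top : volume Ω < ⊤
  perimeter_lt_top : perimeter Ω < ⊤
  perimeter_le : ∀ Ω' : Set (EuclideanSpace ℝ (Fin d)), NullMeasurableSet Ω' volume → Ω ⊆ Ω' →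
    volume Ω' < ⊤ → perimeter Ω ≤ perimeter Ω'

/-- `g` is the weak (distributional) gradient of `u` on `ℝ^d`; used for `u` and `g` in `L²`. -/
def HasWeakGradient {d : ℕ} (u : EuclideanSpace ℝ (Fin d) → ℝ)
    (g : EuclideanSpace ℝ (Fin d) → EuclideanSpace ℝ (Fin d)) : Prop :=
  ∀ φ : EuclideanSpace ℝ (Fin d) → ℝ, ContDiff ℝ ∞ φ → HasCompactSupport φ → ∀ i : Fin d,
    ∫ x, u x * fderiv ℝ φ x (EuclideanSpace.single i 1) = - ∫ x, g x i * φ x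

/-- `u` belongs to `{u ∈ H¹(ℝ^d) : u = 0 a.e. on Ωᶜ}` and `g` is its weak gradient. -/
structure MemSobolevLike {d : ℕ} (Ω : Set (EuclideanSpace ℝ (Fin d)))
    (u : EuclideanSpace ℝ (Fin d) → ℝ)
    (g : EuclideanSpace ℝ (Fin d) → EuclideanSpace ℝ (Fin d)) : Prop where
  memLp : MemLp u 2 volume
  memLp_grad : MemLp g 2 volume
  hasWeakGradient : HasWeakGradient u g
  ae_eq_zero : ∀ᵐ x ∂volume, x ∉ Ω → u x = 0

/-- `w` is (a representative of) the torsion function, or energy function, of the set `Ω` of finite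
measure: the weak solution of `-Δ w = 1` in `{u ∈ H¹(ℝ^d) : u = 0 a.e. on Ωᶜ}`. -/
def IsTorsionFunction {d : ℕ} (Ω : Set (EuclideanSpace ℝ (Fin d)))
    (w : EuclideanSpace ℝ (Fin d) → ℝ) : Prop :=
  ∃ g : EuclideanSpace ℝ (Fin d) → EuclideanSpace ℝ (Fin d), MemSobolevLike Ω w g ∧
    ∀ (v : EuclideanSpace ℝ (Fin d) → ℝ)
      (h : EuclideanSpace ℝ (Fin d) → EuclideanSpace ℝ (Fin d)), MemSobolevLike Ω v h →
      ∫ x, inner ℝ (g x) (h x) = ∫ x, v x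

end

/-!
Perimeter is submodular, so intersecting with a perimeter supersolution `Ω` does not increase the
perimeter. This property passes to translates, to countable intersections and hence to the inner
parallel sets `{δ ≥ t}`, where `δ` is the distance to the support of Lebesgue measure on `Ωᶜ`. By
the coarea formula `∫ |∇δ| ≤ ∫ |∇(δ + v)|` for all `v ≥ 0` vanishing outside of `Ω`, and since
`|∇δ| = 1` in `Ω`, the first variation says that `δ` is weakly superharmonic. With `R` a bound for
`δ`, the function `R δ - δ² / 2` is then a barrier for the torsion function `w`, so that
`0 ≤ w ≤ R δ`. This makes `w(· + a) - R |a|` nonpositive outside of `Ω`, and the comparison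
principle gives `w(· + a) - R |a| ≤ w` for every `a`.
-/

open Filter Set Metric
open scoped Topology Convolution

section GradientGeneral

variable {E : Type*} [NormedAddCommGroup E] [InnerProductSpace ℝ E] [CompleteSpace E]

theorem norm_gradient_le_of_lipschitzWith {C : ℝ≥0} {f : E → ℝ} (hf : LipschitzWith C f) (x : E) :
    ‖gradient f x‖ ≤ C := by
  rw [gradient, LinearIsometryEquiv.norm_map]
  exact norm_fderiv_le_of_lipschitz ℝ hf

theorem support_gradient_subset (f : E → ℝ) : Function.support (gradient f) ⊆ tsupport f := by
  intro x hx
  refine support_fderiv_subset ℝ fun h ↦ hx ?_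
  rw [gradient, h, map_zero]

theorem measurable_gradient [MeasurableSpace E] [BorelSpace E] (f : E → ℝ) :
    Measurable (gradient f) :=
  (InnerProductSpace.toDual ℝ E).symm.continuous.measurable.comp (measurable_fderiv ℝ f)

theorem continuous_gradient_of_contDiff {f : E → ℝ} (hf : ContDiff ℝ 1 f) :
    Continuous (gradient f) :=
  (InnerProductSpace.toDual ℝ E).symm.continuous.comp (hf.continuous_fderiv (by simp))

theorem gradient_comp {Φ : ℝ → ℝ} {f : E → ℝ} {x : E} (hΦ : DifferentiableAt ℝ Φ (f x))
    (hf : DifferentiableAt ℝ f x) :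
    gradient (fun x ↦ Φ (f x)) x = deriv Φ (f x) • gradient f x := by
  have h : fderiv ℝ (fun x ↦ Φ (f x)) x = deriv Φ (f x) • fderiv ℝ f x :=
    (hΦ.hasDerivAt.comp_hasFDerivAt x hf.hasFDerivAt).fderiv
  simp only [gradient, h, map_smul]

theorem gradient_mul {f g : E → ℝ} {x : E} (hf : DifferentiableAt ℝ f x)
    (hg : DifferentiableAt ℝ g x) :
    gradient (fun x ↦ f x * g x) x = f x • gradient g x + g x • gradient f x := by
  simp only [gradient, fderiv_fun_mul hf hg, map_add, map_smul]

end GradientGeneral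

/-! ### Mollification -/

section Mollification

variable {E : Type*} [NormedAddCommGroup E] [InnerProductSpace ℝ E] [FiniteDimensional ℝ E]
  [MeasurableSpace E] [BorelSpace E] {F : Type*} [NormedAddCommGroup F]

theorem locallyIntegrable_of_norm_le_const_mul {F' : Type*} [NormedAddCommGroup F'] {f : E → F}
    {g : E → F'} {C : ℝ} (hf : LocallyIntegrable f) (hg : AEStronglyMeasurable g)
    (hfg : ∀ x, ‖g x‖ ≤ C * ‖f x‖) : LocallyIntegrable g :=
  ((hf.mono hf.aestronglyMeasurable.norm (by simp) : LocallyIntegrable fun x ↦ ‖f x‖).smul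
    C).mono hg (.of_forall fun x ↦ (hfg x).trans (le_abs_self _))

theorem locallyIntegrable_bdd_smul [NormedSpace ℝ F] {f : E → F} {a : E → ℝ} {C : ℝ≥0}
    (hf : LocallyIntegrable f) (ha : AEStronglyMeasurable a) (hC : ∀ x, ‖a x‖ ≤ C) :
    LocallyIntegrable fun x ↦ a x • f x :=
  locallyIntegrable_of_norm_le_const_mul hf (ha.smul hf.aestronglyMeasurable) fun x ↦ by
    rw [norm_smul]
    exact mul_le_mul_of_nonneg_right (hC x) (norm_nonneg _)

theorem locallyIntegrable_smul_gradient {u a : E → ℝ} {C : ℝ≥0} (hu : LocallyIntegrable u)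
    (ha : LipschitzWith C a) : LocallyIntegrable fun x ↦ u x • gradient a x :=
  locallyIntegrable_of_norm_le_const_mul hu
    (hu.aestronglyMeasurable.smul (measurable_gradient a).aestronglyMeasurable) fun x ↦ by
    rw [norm_smul, mul_comm]
    exact mul_le_mul_of_nonneg_right (norm_gradient_le_of_lipschitzWith ha x) (norm_nonneg _)

theorem locallyIntegrable_comp_lipschitzWith {F' : Type*} [NormedAddCommGroup F'] {C : ℝ≥0}
    {Φ : F → F'} (hΦ : LipschitzWith C Φ) {f : E → F} (hf : LocallyIntegrable f) :
    LocallyIntegrable fun x ↦ Φ (f x) := by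
  have hfn := locallyIntegrable_of_norm_le_const_mul (C := 1) hf hf.aestronglyMeasurable.norm
    (by simp)
  refine ((hfn.smul (C : ℝ)).add (locallyIntegrable_const ‖Φ 0‖)).mono
    (hΦ.continuous.comp_aestronglyMeasurable hf.aestronglyMeasurable) (.of_forall fun x ↦ ?_)
  refine le_trans ?_ (le_abs_self _)
  calc ‖Φ (f x)‖ ≤ ‖Φ (f x) - Φ 0‖ + ‖Φ 0‖ := norm_le_norm_sub_add _ _
    _ ≤ C * ‖f x‖ + ‖Φ 0‖ := by simpa using hΦ.norm_sub_le (f x) 0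

/-- Convergence in `L¹` on compact sets. The integrals are lower Lebesgue integrals, so no
integrability of the functions is presupposed. -/
def TendstoInL1Loc (f : ℕ → E → F) (g : E → F) : Prop :=
  ∀ K : Set E, IsCompact K → Tendsto (fun n ↦ ∫⁻ x in K, ‖f n x - g x‖ₑ) atTop (𝓝 0)

theorem TendstoInL1Loc.of_dominated {f : ℕ → E → F} {g : E → F} {G : E → ℝ}
    (hf : ∀ n, AEStronglyMeasurable (f n)) (hG : LocallyIntegrable G)
    (hfG : ∀ n, ∀ᵐ x, ‖f n x‖ ≤ G x) (hlim : ∀ᵐ x, Tendsto (fun n ↦ f n x) atTop (𝓝 (g x))) :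
    TendstoInL1Loc f g := fun K hK ↦ by
  simpa only [ofReal_norm] using tendsto_lintegral_norm_of_dominated_convergence
    (fun n ↦ (hf n).restrict) (hG.integrableOn_isCompact hK).hasFiniteIntegral
    (fun n ↦ ae_restrict_of_ae (hfG n)) (ae_restrict_of_ae hlim)

theorem TendstoInL1Loc.comp_lipschitzWith {F' : Type*} [NormedAddCommGroup F'] {C : ℝ≥0}
    {Φ : F → F'} (hΦ : LipschitzWith C Φ) {f : ℕ → E → F} {g : E → F}
    (h : TendstoInL1Loc f g) : TendstoInL1Loc (fun n x ↦ Φ (f n x)) fun x ↦ Φ (g x) := by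
  intro K hK
  have hC := ENNReal.Tendsto.const_mul (a := (C : ℝ≥0∞)) (h K hK) (.inr ENNReal.coe_ne_top)
  rw [mul_zero] at hC
  refine tendsto_nhds_bot_mono' hC fun n ↦ ?_
  rw [← lintegral_const_mul' _ _ ENNReal.coe_ne_top]
  refine lintegral_mono fun x ↦ ?_
  simpa only [edist_eq_enorm_sub] using hΦ (f n x) (g x)

theorem TendstoInL1Loc.bdd_smul [NormedSpace ℝ F] {b : ℕ → E → ℝ} {b' : E → ℝ} {f : ℕ → E → F}
    {g : E → F} {C : ℝ≥0} (hb : ∀ n, AEStronglyMeasurable (b n)) (hbC : ∀ n x, ‖b n x‖ ≤ C)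
    (hb' : ∀ᵐ x, Tendsto (fun n ↦ b n x) atTop (𝓝 (b' x))) (hg : LocallyIntegrable g)
    (h : TendstoInL1Loc f g) :
    TendstoInL1Loc (fun n x ↦ b n x • f n x) fun x ↦ b' x • g x := by
  intro K hK
  have hgn := locallyIntegrable_comp_lipschitzWith lipschitzWith_one_norm hg
  have hbg : TendstoInL1Loc (fun n x ↦ b n x • g x) fun x ↦ b' x • g x := by
    refine .of_dominated (fun n ↦ (hb n).smul hg.aestronglyMeasurable) (hgn.smul (C : ℝ))
      (fun n ↦ .of_forall fun x ↦ ?_) (hb'.mono fun x hx ↦ hx.smul_const _)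
    rw [norm_smul]
    exact mul_le_mul_of_nonneg_right (hbC n x) (norm_nonneg _)
  have hC := (ENNReal.Tendsto.const_mul (a := (C : ℝ≥0∞)) (h K hK)
    (.inr ENNReal.coe_ne_top)).add (hbg K hK)
  rw [mul_zero, zero_add] at hC
  refine tendsto_nhds_bot_mono' hC fun n ↦ ?_
  rw [← lintegral_const_mul' _ _ ENNReal.coe_ne_top]
  refine (lintegral_mono fun x ↦ ?_).trans (lintegral_add_right' _ ?_).le
  · calc ‖b n x • f n x - b' x • g x‖ₑ
        = ‖b n x • (f n x - g x) + (b n x • g x - b' x • g x)‖ₑ := by rw [smul_sub]; abel_nf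
      _ ≤ ‖b n x • (f n x - g x)‖ₑ + ‖b n x • g x - b' x • g x‖ₑ := enorm_add_le _ _
      _ ≤ C * ‖f n x - g x‖ₑ + ‖b n x • g x - b' x • g x‖ₑ := by
        rw [enorm_smul]
        gcongr
        exact enorm_le_coe.2 (hbC n x)
  · have hb'm : AEStronglyMeasurable b' := aestronglyMeasurable_of_tendsto_ae _ hb hb'
    exact (((hb n).smul hg.aestronglyMeasurable).sub
      (hb'm.smul hg.aestronglyMeasurable)).restrict.enorm

theorem TendstoInL1Loc.tendsto_integral_mul {f : ℕ → E → ℝ} {g ψ : E → ℝ}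
    (h : TendstoInL1Loc f g) (hf : ∀ n, LocallyIntegrable (f n)) (hg : LocallyIntegrable g)
    (hψ : Continuous ψ) (hc : HasCompactSupport ψ) :
    Tendsto (fun n ↦ ∫ x, f n x * ψ x) atTop (𝓝 (∫ x, g x * ψ x)) := by
  obtain ⟨C, hC⟩ := hc.exists_bound_of_continuous hψ
  have hC' : ∀ x, ‖ψ x‖ₑ ≤ C.toNNReal := fun x ↦
    enorm_le_coe.2 ((hC x).trans (Real.le_coe_toNNReal C))
  refine tendsto_integral_of_L1 _ (hg.integrable_smul_right_of_hasCompactSupport hψ hc).1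
    (.of_forall fun n ↦ (hf n).integrable_smul_right_of_hasCompactSupport hψ hc) ?_
  have hlim := ENNReal.Tendsto.mul_const (b := (C.toNNReal : ℝ≥0∞)) (h _ hc)
    (.inr ENNReal.coe_ne_top)
  rw [zero_mul] at hlim
  refine tendsto_nhds_bot_mono' hlim fun n ↦ ?_
  rw [← lintegral_mul_const' _ _ ENNReal.coe_ne_top,
    ← lintegral_indicator (isClosed_tsupport ψ).measurableSet]
  refine lintegral_mono fun x ↦ ?_
  by_cases hx : x ∈ tsupport ψ
  · rw [indicator_of_mem hx, smul_eq_mul, ← sub_mul, enorm_mul]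
    gcongr
    exact hC' x
  · simp [image_eq_zero_of_notMem_tsupport hx]

variable (E) in
/-- The bump function around the origin with radii `1 / (2 (n + 1))` and `1 / (n + 1)`. -/
noncomputable def mollifierBump (n : ℕ) : ContDiffBump (0 : E) where
  rIn := 1 / (2 * (n + 1))
  rOut := 1 / (n + 1)
  rIn_pos := by positivity
  rIn_lt_rOut := by
    apply one_div_lt_one_div_of_lt <;> linarith [n.cast_nonneg (α := ℝ)]

variable (E) in
/-- The standard mollifier: a smooth even probability density supported in the ball of radius
`1 / (n + 1)`. -/
noncomputable def mollifier (n : ℕ) : E → ℝ := (mollifierBump E n).normed volume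

theorem mollifier_nonneg (n : ℕ) (x : E) : 0 ≤ mollifier E n x :=
  (mollifierBump E n).nonneg_normed x

theorem mollifier_sub_comm (n : ℕ) (x y : E) : mollifier E n (x - y) = mollifier E n (y - x) := by
  rw [← neg_sub]
  exact (mollifierBump E n).normed_neg _

theorem contDiff_mollifier (n : ℕ) : ContDiff ℝ ∞ (mollifier E n) :=
  (mollifierBump E n).contDiff_normed

theorem continuous_mollifier (n : ℕ) : Continuous (mollifier E n) :=
  (contDiff_mollifier n).continuous

theorem hasCompactSupport_mollifier (n : ℕ) : HasCompactSupport (mollifier E n) :=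
  (mollifierBump E n).hasCompactSupport_normed

theorem integrable_mollifier (n : ℕ) : Integrable (mollifier E n) :=
  (mollifierBump E n).integrable_normed

theorem integral_mollifier (n : ℕ) : ∫ x, mollifier E n x = 1 :=
  (mollifierBump E n).integral_normed

theorem support_mollifier_subset (n : ℕ) : Function.support (mollifier E n) ⊆ closedBall 0 1 := by
  rw [mollifier, ContDiffBump.support_normed_eq]
  refine ball_subset_closedBall.trans (closedBall_subset_closedBall ?_)
  exact Nat.one_div_le_one_div (Nat.zero_le n) |>.trans (by norm_num)

variable [NormedSpace ℝ F]

/-- The convolution of `f` with the mollifier of index `n`. -/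
noncomputable def mollify (n : ℕ) (f : E → F) : E → F :=
  mollifier E n ⋆[ContinuousLinearMap.lsmul ℝ ℝ, volume] f

theorem mollify_apply (n : ℕ) (f : E → F) (x : E) :
    mollify n f x = ∫ t, mollifier E n (x - t) • f t :=
  convolution_lsmul_swap

theorem integrable_mollifier_smul (n : ℕ) {f : E → F} (hf : LocallyIntegrable f) (x : E) :
    Integrable fun t ↦ mollifier E n (x - t) • f t :=
  ConvolutionExistsAt.integrable_swap <| (hasCompactSupport_mollifier n).convolutionExists_left
    (ContinuousLinearMap.lsmul ℝ ℝ) (continuous_mollifier n) hf x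

theorem norm_mollify_apply_le (n : ℕ) (f : E → F) (x : E) :
    ‖mollify n f x‖ ≤ mollify n (fun y ↦ ‖f y‖) x := by
  rw [mollify_apply, mollify_apply]
  refine (norm_integral_le_integral_norm _).trans_eq ?_
  simp only [norm_smul, Real.norm_of_nonneg (mollifier_nonneg n _), smul_eq_mul]

theorem norm_mollify_le (n : ℕ) {f : E → F} {C : ℝ} (hf : ∀ x, ‖f x‖ ≤ C) (x : E) :
    ‖mollify n f x‖ ≤ C := by
  rw [mollify_apply]
  calc ‖∫ t, mollifier E n (x - t) • f t‖ ≤ ∫ t, mollifier E n (x - t) * C := by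
        refine norm_integral_le_of_norm_le (((integrable_mollifier n).comp_sub_left x).mul_const C)
          (.of_forall fun t ↦ ?_)
        rw [norm_smul, Real.norm_of_nonneg (mollifier_nonneg n _)]
        exact mul_le_mul_of_nonneg_left (hf t) (mollifier_nonneg n _)
    _ = C := by
        rw [integral_mul_const, integral_sub_left_eq_self, integral_mollifier, one_mul]

theorem mollify_sub (n : ℕ) {f g : E → F} (hf : LocallyIntegrable f) (hg : LocallyIntegrable g)
    (x : E) : mollify n (fun x ↦ f x - g x) x = mollify n f x - mollify n g x := by
  simp_rw [mollify_apply, smul_sub]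
  exact integral_sub (integrable_mollifier_smul n hf x) (integrable_mollifier_smul n hg x)

theorem mollify_congr_of_eqOn (n : ℕ) {f g : E → F} {x : E} (h : EqOn f g (closedBall x 1)) :
    mollify n f x = mollify n g x := by
  rw [mollify_apply, mollify_apply]
  congr 1 with t
  by_cases ht : mollifier E n (x - t) = 0
  · rw [ht, zero_smul, zero_smul]
  · have htx : t ∈ closedBall x 1 := by
      rw [mem_closedBall, dist_comm, dist_eq_norm, ← mem_closedBall_zero_iff]
      exact support_mollifier_subset n ht
    rw [h htx]

theorem mollify_eq_zero_of_notMem (n : ℕ) {f : E → F} {S : Set E} (hS : Function.support f ⊆ S)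
    {x : E} (hx : x ∉ cthickening 1 S) : mollify n f x = 0 := by
  have hf : EqOn f (fun _ ↦ (0 : F)) (closedBall x 1) := fun y hy ↦ by
    by_contra h
    exact hx (mem_cthickening_of_dist_le x y 1 _ (hS h) (mem_closedBall'.1 hy))
  simp only [mollify_congr_of_eqOn n hf, mollify_apply, smul_zero, integral_zero]

theorem hasCompactSupport_mollify (n : ℕ) {f : E → F} (hf : HasCompactSupport f) :
    HasCompactSupport (mollify n f) :=
  (hasCompactSupport_mollifier n).convolution _ hf

theorem integral_mollify_mul (n : ℕ) {f g : E → ℝ} (hf : Integrable f) (hg : Integrable g) :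
    ∫ x, mollify n f x * g x = ∫ x, f x * mollify n g x := by
  obtain ⟨C, hC⟩ := (hasCompactSupport_mollifier (E := E) n).exists_bound_of_continuous
    (continuous_mollifier n)
  have hint : Integrable (Function.uncurry fun x t ↦ mollifier E n (x - t) * (g x * f t))
      ((volume : Measure E).prod (volume : Measure E)) := by
    refine (hg.mul_prod hf).bdd_mul (c := C) ?_ (.of_forall fun p ↦ hC _)
    exact ((continuous_mollifier n).comp (continuous_fst.sub continuous_snd)).aestronglyMeasurable
  calc ∫ x, mollify n f x * g x = ∫ x, ∫ t, mollifier E n (x - t) * (g x * f t) := by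
        simp_rw [mollify_apply, ← integral_mul_const, smul_eq_mul, mul_assoc, mul_comm (f _)]
    _ = ∫ t, ∫ x, mollifier E n (x - t) * (g x * f t) := integral_integral_swap hint
    _ = ∫ t, f t * mollify n g t := by
        congr with t
        rw [mollify_apply, ← integral_const_mul]
        congr with x
        rw [mollifier_sub_comm, smul_eq_mul]
        ring

theorem integral_mollify_mul_of_hasCompactSupport (n : ℕ) {f g : E → ℝ} (hf : LocallyIntegrable f)
    (hg : Integrable g) (hc : HasCompactSupport g) :
    ∫ x, mollify n f x * g x = ∫ x, f x * mollify n g x := by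
  set K := cthickening 1 (tsupport g)
  have hK : IsCompact K := hc.isCompact.cthickening
  have hfK : Integrable (K.indicator f) :=
    (hf.integrableOn_isCompact hK).integrable_indicator hK.measurableSet
  calc ∫ x, mollify n f x * g x = ∫ x, mollify n (K.indicator f) x * g x := by
        congr with x
        by_cases hx : g x = 0
        · simp [hx]
        · rw [mollify_congr_of_eqOn n fun y hy ↦ (indicator_of_mem ?_ f).symm]
          exact mem_cthickening_of_dist_le y x 1 _ (subset_tsupport g hx) hy
    _ = ∫ x, K.indicator f x * mollify n g x := integral_mollify_mul n hfK hg
    _ = ∫ x, f x * mollify n g x := by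
        congr with x
        by_cases hx : x ∈ K
        · rw [indicator_of_mem hx]
        · simp [mollify_eq_zero_of_notMem n (subset_tsupport g) hx]

theorem contDiff_mollify (n : ℕ) {f : E → F} (hf : LocallyIntegrable f) :
    ContDiff ℝ ∞ (mollify n f) :=
  (hasCompactSupport_mollifier n).contDiff_convolution_left _ (contDiff_mollifier n) hf

theorem integrable_mollify (n : ℕ) {f : E → F} (hf : Integrable f) : Integrable (mollify n f) :=
  (integrable_mollifier n).integrable_convolution _ hf

theorem integral_mollify [CompleteSpace F] (n : ℕ) {f : E → F} (hf : Integrable f) :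
    ∫ x, mollify n f x = ∫ x, f x := by
  rw [mollify, integral_convolution _ (integrable_mollifier n) hf, integral_mollifier]
  simp

theorem integral_norm_mollify_le (n : ℕ) {f : E → F} (hf : Integrable f) :
    ∫ x, ‖mollify n f x‖ ≤ ∫ x, ‖f x‖ := by
  rw [← integral_mollify n hf.norm]
  exact integral_mono (integrable_mollify n hf).norm (integrable_mollify n hf.norm)
    (norm_mollify_apply_le n f)

variable [CompleteSpace F]

theorem ae_tendsto_mollify {f : E → F} (hf : LocallyIntegrable f) :
    ∀ᵐ x, Tendsto (fun n ↦ mollify n f x) atTop (𝓝 (f x)) := by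
  refine ContDiffBump.ae_convolution_tendsto_right_of_locallyIntegrable (K := 2)
    tendsto_one_div_add_atTop_nhds_zero_nat (.of_forall fun n ↦ ?_) hf
  change 1 / ((n : ℝ) + 1) ≤ 2 * (1 / (2 * (n + 1)))
  apply le_of_eq
  field_simp

theorem tendsto_integral_norm_mollify_sub_of_hasCompactSupport {f : E → F} (hf : Continuous f)
    (hc : HasCompactSupport f) :
    Tendsto (fun n ↦ ∫ x, ‖mollify n f x - f x‖) atTop (𝓝 0) := by
  obtain ⟨C, hC⟩ := hc.exists_bound_of_continuous hf
  have hK : IsCompact (cthickening 1 (tsupport f)) := hc.isCompact.cthickening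
  have hfi : Integrable f := hf.integrable_of_hasCompactSupport hc
  rw [← integral_zero E ℝ]
  refine tendsto_integral_of_dominated_convergence
    ((cthickening 1 (tsupport f)).indicator fun _ ↦ C + C)
    (fun n ↦ ((integrable_mollify n hfi).sub hfi).norm.aestronglyMeasurable)
    (IntegrableOn.integrable_indicator (integrableOn_const (μ := volume) hK.measure_lt_top.ne)
      hK.measurableSet)
    (fun n ↦ .of_forall fun x ↦ ?_) ?_
  · rw [norm_norm]
    by_cases hx : x ∈ cthickening 1 (tsupport f)
    · rw [indicator_of_mem hx]
      exact (norm_sub_le _ _).trans (add_le_add (norm_mollify_le n hC x) (hC x))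
    · have hfx : f x = 0 := image_eq_zero_of_notMem_tsupport
        fun h ↦ hx (self_subset_cthickening _ h)
      rw [indicator_of_notMem hx, mollify_eq_zero_of_notMem n (subset_tsupport f) hx, hfx,
        sub_zero, norm_zero]
  · filter_upwards [ae_tendsto_mollify hf.locallyIntegrable] with x hx
    simpa using (hx.sub_const (f x)).norm

theorem tendsto_integral_norm_mollify_sub {f : E → F} (hf : Integrable f) :
    Tendsto (fun n ↦ ∫ x, ‖mollify n f x - f x‖) atTop (𝓝 0) := by
  refine tendsto_order.2 ⟨fun a ha ↦ .of_forall fun n ↦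
    ha.trans_le (integral_nonneg fun x ↦ norm_nonneg _), fun ε hε ↦ ?_⟩
  obtain ⟨g, hgc, hfg, hg, hgi⟩ := hf.exists_hasCompactSupport_integral_sub_le
    (show 0 < ε / 3 by positivity)
  have hlim := tendsto_integral_norm_mollify_sub_of_hasCompactSupport hg hgc
  filter_upwards [hlim.eventually_lt_const (show 0 < ε / 3 by positivity)] with n hn
  have i₁ : Integrable fun x ↦ ‖mollify n (fun y ↦ f y - g y) x‖ :=
    (integrable_mollify n (hf.sub hgi)).norm
  have i₂ : Integrable fun x ↦ ‖mollify n g x - g x‖ := ((integrable_mollify n hgi).sub hgi).norm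
  have i₃ : Integrable fun x ↦ ‖f x - g x‖ := (hf.sub hgi).norm
  have i₁₂ : Integrable fun x ↦ ‖mollify n (fun y ↦ f y - g y) x‖ + ‖mollify n g x - g x‖ :=
    i₁.add i₂
  calc ∫ x, ‖mollify n f x - f x‖
      ≤ ∫ x, (‖mollify n (fun y ↦ f y - g y) x‖ + ‖mollify n g x - g x‖ + ‖f x - g x‖) := by
        refine integral_mono ((integrable_mollify n hf).sub hf).norm (i₁₂.add i₃) fun x ↦ ?_
        rw [mollify_sub n hf.locallyIntegrable hgi.locallyIntegrable]
        refine le_trans (le_of_eq ?_) ((norm_sub_le _ (f x - g x)).trans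
          (add_le_add_left (norm_add_le _ _) _))
        congr 1
        abel
    _ = (∫ x, ‖mollify n (fun y ↦ f y - g y) x‖) + (∫ x, ‖mollify n g x - g x‖)
        + ∫ x, ‖f x - g x‖ := by
        rw [integral_add i₁₂ i₃, integral_add i₁ i₂]
    _ < ε / 3 + ε / 3 + ε / 3 :=
        add_lt_add_of_lt_of_le (add_lt_add_of_le_of_lt
          ((integral_norm_mollify_le n (hf.sub hgi)).trans hfg) hn) hfg
    _ = ε := by ring

theorem tendstoInL1Loc_mollify {f : E → F} (hf : LocallyIntegrable f) :
    TendstoInL1Loc (fun n ↦ mollify n f) f := by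
  intro K hK
  set K₁ := cthickening 1 K
  have hK₁ : IsCompact K₁ := hK.cthickening
  have hf₁ : Integrable (K₁.indicator f) :=
    (hf.integrableOn_isCompact hK₁).integrable_indicator hK₁.measurableSet
  have hlim := ENNReal.tendsto_ofReal (tendsto_integral_norm_mollify_sub hf₁)
  rw [ENNReal.ofReal_zero] at hlim
  refine tendsto_nhds_bot_mono' hlim fun n ↦ ?_
  refine le_of_le_of_eq ?_
    (ofReal_integral_norm_eq_lintegral_enorm ((integrable_mollify n hf₁).sub hf₁)).symm
  refine le_trans (lintegral_mono_ae ?_) (setLIntegral_le_lintegral K _)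
  filter_upwards [ae_restrict_mem hK.measurableSet] with x hx
  have hsub : closedBall x 1 ⊆ K₁ := closedBall_subset_cthickening hx 1
  rw [mollify_congr_of_eqOn n fun y hy ↦ (indicator_of_mem (hsub hy) f).symm,
    ← indicator_of_mem (hsub (mem_closedBall_self zero_le_one)) f, Pi.sub_apply]

theorem tendsto_integral_inner_mollify {H : Type*} [NormedAddCommGroup H] [InnerProductSpace ℝ H]
    [CompleteSpace H] {v f : E → H} {M : ℝ} (hv : LocallyIntegrable v)
    (hf : LocallyIntegrable f) (hM : ∀ x, ‖f x‖ ≤ M) {K : Set E} (hK : IsCompact K)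
    (hfK : Function.support f ⊆ K) :
    Tendsto (fun n ↦ ∫ x, inner ℝ (v x) (mollify n f x)) atTop (𝓝 (∫ x, inner ℝ (v x) (f x))) := by
  refine tendsto_integral_of_dominated_convergence
    ((cthickening 1 K).indicator fun x ↦ ‖v x‖ * M)
    (fun n ↦ hv.aestronglyMeasurable.inner (contDiff_mollify n hf).continuous.aestronglyMeasurable)
    (IntegrableOn.integrable_indicator ((hv.integrableOn_isCompact hK.cthickening).norm.mul_const M)
      isClosed_cthickening.measurableSet)
    (fun n ↦ .of_forall fun x ↦ ?_)
    ((ae_tendsto_mollify hf).mono fun x hx ↦ tendsto_const_nhds.inner hx)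
  by_cases hx : x ∈ cthickening 1 K
  · rw [indicator_of_mem hx]
    exact (norm_inner_le_norm _ _).trans
      (mul_le_mul_of_nonneg_left (norm_mollify_le n hM x) (norm_nonneg _))
  · simp [mollify_eq_zero_of_notMem n hfK hx, indicator_of_notMem hx]

end Mollification

noncomputable section

variable {d : ℕ}

local notation "ℝᵈ" => EuclideanSpace ℝ (Fin d)

/-! ### Weak gradients -/

section WeakGradient

theorem gradient_apply (f : ℝᵈ → ℝ) (x : ℝᵈ) (i : Fin d) :
    gradient f x i = fderiv ℝ f x (EuclideanSpace.single i 1) := by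
  rw [← inner_gradient_left, EuclideanSpace.inner_single_right]
  simp

theorem locallyIntegrable_coord {g : ℝᵈ → ℝᵈ} (hg : LocallyIntegrable g) (i : Fin d) :
    LocallyIntegrable fun x ↦ g x i := fun x ↦
  let ⟨s, hs, hgs⟩ := hg x
  ⟨s, hs, (EuclideanSpace.proj i : ℝᵈ →L[ℝ] ℝ).integrable_comp hgs⟩

theorem mollify_coord {g : ℝᵈ → ℝᵈ} (hg : LocallyIntegrable g) (n : ℕ) (x : ℝᵈ) (i : Fin d) :
    mollify n g x i = mollify n (fun y ↦ g y i) x := by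
  rw [mollify_apply, mollify_apply]
  exact ((EuclideanSpace.proj (𝕜 := ℝ) i : ℝᵈ →L[ℝ] ℝ).integral_comp_comm
    (integrable_mollifier_smul n hg x)).symm

/-- `u` belongs to the Sobolev space `W^{1,1}_loc(ℝ^d)` and `g` is its weak gradient. -/
structure MemSobolevLoc (u : ℝᵈ → ℝ) (g : ℝᵈ → ℝᵈ) : Prop where
  locallyIntegrable : LocallyIntegrable u
  locallyIntegrable_grad : LocallyIntegrable g
  hasWeakGradient : HasWeakGradient u g

theorem MemSobolevLike.memSobolevLoc {Ω : Set ℝᵈ} {u : ℝᵈ → ℝ} {g : ℝᵈ → ℝᵈ}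
    (h : MemSobolevLike Ω u g) : MemSobolevLoc u g :=
  ⟨h.memLp.locallyIntegrable one_le_two, h.memLp_grad.locallyIntegrable one_le_two,
    h.hasWeakGradient⟩

theorem memSobolevLoc_of_contDiff {f : ℝᵈ → ℝ} (hf : ContDiff ℝ 1 f) :
    MemSobolevLoc f (gradient f) := by
  have hg := (continuous_gradient_of_contDiff hf).locallyIntegrable (μ := volume)
  refine ⟨hf.continuous.locallyIntegrable, hg, fun φ hφ hc i ↦ ?_⟩
  have hφ' : Continuous fun x ↦ fderiv ℝ φ x (EuclideanSpace.single i 1) :=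
    (hφ.continuous_fderiv (by simp)).clm_apply continuous_const
  have hgφ := (locallyIntegrable_coord hg i).integrable_smul_right_of_hasCompactSupport
    hφ.continuous hc
  simp only [gradient_apply, smul_eq_mul] at hgφ ⊢
  exact integral_mul_fderiv_eq_neg_fderiv_mul_of_integrable hgφ
    (hf.continuous.locallyIntegrable.integrable_smul_right_of_hasCompactSupport hφ'
      (hc.fderiv_apply (𝕜 := ℝ) _))
    (hf.continuous.locallyIntegrable.integrable_smul_right_of_hasCompactSupport hφ.continuous hc)
    (fun x _ ↦ hf.differentiable (by simp) x) (fun x _ ↦ hφ.differentiable (by simp) x)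

theorem memSobolevLoc_of_lipschitzWith {C : ℝ≥0} {f : ℝᵈ → ℝ} (hf : LipschitzWith C f) :
    MemSobolevLoc f (gradient f) := by
  refine ⟨hf.continuous.locallyIntegrable, (memLp_top_of_bound
    (measurable_gradient f).aestronglyMeasurable C
    (.of_forall (norm_gradient_le_of_lipschitzWith hf))).locallyIntegrable le_top,
    fun φ hφ hc i ↦ ?_⟩
  obtain ⟨D, hD⟩ := ContDiff.lipschitzWith_of_hasCompactSupport hc hφ (by simp)
  have hf' : (fun x ↦ gradient f x i * φ x) =ᵐ[volume]
      fun x ↦ lineDeriv ℝ f x (EuclideanSpace.single i 1) * φ x := by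
    filter_upwards [hf.ae_differentiableAt (μ := volume)] with x hx
    rw [hx.lineDeriv_eq_fderiv, gradient_apply]
  have hφ' : ∀ x, lineDeriv ℝ φ x (-EuclideanSpace.single i 1) * f x =
      -(f x * fderiv ℝ φ x (EuclideanSpace.single i 1)) := fun x ↦ by
    rw [((hφ.differentiable (by simp)) x).lineDeriv_eq_fderiv, map_neg, neg_mul, mul_comm]
  rw [integral_congr_ae hf',
    hf.integral_lineDeriv_mul_eq (μ := volume) hD hc (EuclideanSpace.single i 1),
    integral_congr_ae (.of_forall hφ'), integral_neg, neg_neg]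

namespace MemSobolevLoc

variable {u v : EuclideanSpace ℝ (Fin d) → ℝ}
  {g h : EuclideanSpace ℝ (Fin d) → EuclideanSpace ℝ (Fin d)}

theorem integrable_mul_fderiv (hu : MemSobolevLoc u g) {φ : ℝᵈ → ℝ} (hφ : ContDiff ℝ 1 φ)
    (hc : HasCompactSupport φ) (i : Fin d) :
    Integrable fun x ↦ u x * fderiv ℝ φ x (EuclideanSpace.single i 1) :=
  hu.locallyIntegrable.integrable_smul_right_of_hasCompactSupport
    ((hφ.continuous_fderiv (by simp)).clm_apply continuous_const) (hc.fderiv_apply (𝕜 := ℝ) _)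

theorem integrable_coord_mul (hu : MemSobolevLoc u g) {φ : ℝᵈ → ℝ} (hφ : Continuous φ)
    (hc : HasCompactSupport φ) (i : Fin d) : Integrable fun x ↦ g x i * φ x :=
  (locallyIntegrable_coord hu.locallyIntegrable_grad i).integrable_smul_right_of_hasCompactSupport
    hφ hc

theorem congr {u' : ℝᵈ → ℝ} {g' : ℝᵈ → ℝᵈ} (hu : MemSobolevLoc u g) (huu' : u =ᵐ[volume] u')
    (hgg' : g =ᵐ[volume] g') : MemSobolevLoc u' g' := by
  refine ⟨hu.locallyIntegrable.congr huu', hu.locallyIntegrable_grad.congr hgg',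
    fun φ hφ hc i ↦ ?_⟩
  have hl : (fun x ↦ u x * fderiv ℝ φ x (EuclideanSpace.single i 1)) =ᵐ[volume]
      fun x ↦ u' x * fderiv ℝ φ x (EuclideanSpace.single i 1) :=
    huu'.mono fun x hx ↦ by simp only [hx]
  have hr : (fun x ↦ g x i * φ x) =ᵐ[volume] fun x ↦ g' x i * φ x :=
    hgg'.mono fun x hx ↦ by simp only [hx]
  rw [← integral_congr_ae hl, ← integral_congr_ae hr, hu.hasWeakGradient φ hφ hc i]

theorem add (hu : MemSobolevLoc u g) (hv : MemSobolevLoc v h) :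
    MemSobolevLoc (fun x ↦ u x + v x) fun x ↦ g x + h x := by
  refine ⟨hu.locallyIntegrable.add hv.locallyIntegrable,
    hu.locallyIntegrable_grad.add hv.locallyIntegrable_grad, fun φ hφ hc i ↦ ?_⟩
  simp only [add_mul, PiLp.add_apply]
  rw [integral_add (hu.integrable_mul_fderiv (hφ.of_le (by simp)) hc i)
      (hv.integrable_mul_fderiv (hφ.of_le (by simp)) hc i),
    integral_add (hu.integrable_coord_mul hφ.continuous hc i)
      (hv.integrable_coord_mul hφ.continuous hc i),
    hu.hasWeakGradient φ hφ hc i, hv.hasWeakGradient φ hφ hc i, neg_add]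

theorem const_mul (hu : MemSobolevLoc u g) (c : ℝ) :
    MemSobolevLoc (fun x ↦ c * u x) fun x ↦ c • g x := by
  refine ⟨hu.locallyIntegrable.smul c, hu.locallyIntegrable_grad.smul c, fun φ hφ hc i ↦ ?_⟩
  simp only [PiLp.smul_apply, smul_eq_mul, mul_assoc]
  rw [integral_const_mul, integral_const_mul, hu.hasWeakGradient φ hφ hc i, mul_neg]

theorem neg (hu : MemSobolevLoc u g) : MemSobolevLoc (fun x ↦ -u x) fun x ↦ -g x := by
  simpa using hu.const_mul (-1)

theorem sub (hu : MemSobolevLoc u g) (hv : MemSobolevLoc v h) :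
    MemSobolevLoc (fun x ↦ u x - v x) fun x ↦ g x - h x := by
  simpa only [sub_eq_add_neg] using hu.add hv.neg

theorem add_const (hu : MemSobolevLoc u g) (c : ℝ) : MemSobolevLoc (fun x ↦ u x + c) g := by
  have hc := memSobolevLoc_of_contDiff (contDiff_const (E := ℝᵈ) (c := c) (𝕜 := ℝ) (n := 1))
  simpa using hu.add hc

theorem comp_add (hu : MemSobolevLoc u g) (a : ℝᵈ) :
    MemSobolevLoc (fun x ↦ u (x + a)) fun x ↦ g (x + a) := by
  have hmap : Measure.map (Homeomorph.addRight a) (volume : Measure ℝᵈ) = volume :=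
    (measurePreserving_add_right volume a).map_eq
  refine ⟨(locallyIntegrable_map_homeomorph (Homeomorph.addRight a)).1
      (hmap.symm ▸ hu.locallyIntegrable),
    (locallyIntegrable_map_homeomorph (Homeomorph.addRight a)).1
      (hmap.symm ▸ hu.locallyIntegrable_grad), fun φ hφ hc i ↦ ?_⟩
  have hug := hu.hasWeakGradient (fun y ↦ φ (y - a)) (hφ.comp (contDiff_id.sub contDiff_const))
    (hc.comp_homeomorph (Homeomorph.subRight a)) i
  simp_rw [fderiv_comp_sub] at hug
  rw [← integral_add_right_eq_self _ a,
    ← integral_add_right_eq_self (fun x ↦ g x i * φ (x - a)) a] at hug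
  simpa only [add_sub_cancel_right] using hug

theorem ae_eq (hg : MemSobolevLoc u g) (hh : MemSobolevLoc u h) : g =ᵐ[volume] h := by
  have hcoord : ∀ i, ∀ᵐ x, g x i = h x i := fun i ↦ by
    refine ae_eq_of_integral_contDiff_smul_eq (locallyIntegrable_coord hg.locallyIntegrable_grad i)
      (locallyIntegrable_coord hh.locallyIntegrable_grad i) fun φ hφ hc ↦ ?_
    simpa [mul_comm] using
      (hg.hasWeakGradient φ hφ hc i).symm.trans (hh.hasWeakGradient φ hφ hc i)
  filter_upwards [ae_all_iff.2 hcoord] with x hx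
  ext i
  exact hx i

theorem gradient_mollify (hu : MemSobolevLoc u g) (n : ℕ) (x : ℝᵈ) :
    gradient (mollify n u) x = mollify n g x := by
  have hρ : ContDiff ℝ 1 (mollifier ℝᵈ n) := (contDiff_mollifier n).of_le (by simp)
  have hρc := hasCompactSupport_mollifier (E := ℝᵈ) n
  ext i
  have hder : ∀ y, fderiv ℝ (fun y ↦ mollifier ℝᵈ n (x - y)) y (EuclideanSpace.single i 1) =
      -fderiv ℝ (mollifier ℝᵈ n) (x - y) (EuclideanSpace.single i 1) := fun y ↦ by
    have hcomp : HasFDerivAt (fun y ↦ mollifier ℝᵈ n (x - y)) _ y :=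
      (hρ.differentiable (by simp) (x - y)).hasFDerivAt.comp y ((hasFDerivAt_id y).const_sub x)
    rw [hcomp.fderiv]
    simp
  have hug := hu.hasWeakGradient (fun y ↦ mollifier ℝᵈ n (x - y))
    ((contDiff_mollifier n).comp (contDiff_const.sub contDiff_id))
    (hρc.comp_homeomorph (Homeomorph.subLeft x)) i
  simp only [hder, mul_neg, integral_neg, neg_inj] at hug
  calc gradient (mollify n u) x i
      = ∫ t, u t * fderiv ℝ (mollifier ℝᵈ n) (x - t) (EuclideanSpace.single i 1) := by
        have hint := ((hρc.fderiv (𝕜 := ℝ)).convolutionExists_left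
          (ContinuousLinearMap.precompL ℝᵈ (ContinuousLinearMap.lsmul ℝ ℝ))
          (hρ.continuous_fderiv (by simp)) hu.locallyIntegrable x).integrable_swap
        rw [gradient_apply, mollify, (hρc.hasFDerivAt_convolution_left
            (ContinuousLinearMap.lsmul ℝ ℝ) hρ hu.locallyIntegrable x).fderiv,
          convolution_eq_swap, ContinuousLinearMap.integral_apply hint]
        simp [ContinuousLinearMap.precompL_apply, mul_comm]
    _ = ∫ t, mollifier ℝᵈ n (x - t) • g t i := by simp only [hug, smul_eq_mul, mul_comm]
    _ = mollify n g x i := by rw [mollify_coord hu.locallyIntegrable_grad, mollify_apply]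

theorem integral_mul_gradient (hu : MemSobolevLoc u g) {C : ℝ≥0} {φ : ℝᵈ → ℝ}
    (hφ : LipschitzWith C φ) (hc : HasCompactSupport φ) (i : Fin d) :
    ∫ x, u x * gradient φ x i = -∫ x, g x i * φ x := by
  have hφi := memSobolevLoc_of_lipschitzWith hφ
  obtain ⟨M, hM⟩ := hc.exists_bound_of_continuous hφ.continuous
  have hl := tendsto_integral_inner_mollify hu.locallyIntegrable
    (locallyIntegrable_coord hφi.locallyIntegrable_grad i)
    (fun x ↦ (PiLp.norm_apply_le _ i).trans (norm_gradient_le_of_lipschitzWith hφ x)) hc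
    fun x hx ↦ support_gradient_subset φ fun h ↦ hx (by simp [h])
  have hr := tendsto_integral_inner_mollify (locallyIntegrable_coord hu.locallyIntegrable_grad i)
    hφi.locallyIntegrable hM hc (subset_tsupport φ)
  simp only [Real.inner_apply] at hl hr
  refine tendsto_nhds_unique hl (hr.neg.congr fun n ↦ ?_)
  rw [← hu.hasWeakGradient _ (contDiff_mollify n hφi.locallyIntegrable)
    (hasCompactSupport_mollify n hc) i]
  simp_rw [← gradient_apply, hφi.gradient_mollify, mollify_coord hφi.locallyIntegrable_grad]

theorem integral_mul_fderiv (hu : MemSobolevLoc u g) {φ : ℝᵈ → ℝ} (hφ : ContDiff ℝ 1 φ)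
    (hc : HasCompactSupport φ) (i : Fin d) :
    ∫ x, u x * fderiv ℝ φ x (EuclideanSpace.single i 1) = -∫ x, g x i * φ x := by
  obtain ⟨D, hD⟩ := ContDiff.lipschitzWith_of_hasCompactSupport hc hφ (by simp)
  simp_rw [← hu.integral_mul_gradient hD hc i, gradient_apply]

theorem of_tendstoInL1Loc {u' : ℕ → ℝᵈ → ℝ} {g' : ℕ → ℝᵈ → ℝᵈ}
    (hu' : ∀ n, MemSobolevLoc (u' n) (g' n)) (hu : LocallyIntegrable u) (hg : LocallyIntegrable g)
    (huu' : TendstoInL1Loc u' u) (hgg' : TendstoInL1Loc g' g) : MemSobolevLoc u g := by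
  refine ⟨hu, hg, fun φ hφ hc i ↦ ?_⟩
  have hl := huu'.tendsto_integral_mul (fun n ↦ (hu' n).locallyIntegrable) hu
    ((hφ.continuous_fderiv (by simp)).clm_apply continuous_const)
    (hc.fderiv_apply (𝕜 := ℝ) (EuclideanSpace.single i 1))
  have hr := (hgg'.comp_lipschitzWith
      (EuclideanSpace.proj (𝕜 := ℝ) i : ℝᵈ →L[ℝ] ℝ).lipschitz).tendsto_integral_mul
    (fun n ↦ locallyIntegrable_coord (hu' n).locallyIntegrable_grad i)
    (locallyIntegrable_coord hg i) hφ.continuous hc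
  exact tendsto_nhds_unique hl
    (hr.neg.congr fun n ↦ ((hu' n).hasWeakGradient φ hφ hc i).symm)

end MemSobolevLoc

end WeakGradient

/-! ### Chain rule for weak gradients -/

section ChainRule

theorem deriv_smoothTransition_eq_zero {t : ℝ} (ht : t ∉ Ioo 0 1) :
    deriv Real.smoothTransition t = 0 := by
  rcases le_or_gt t 0 with h0 | h0
  · refine IsLocalMin.deriv_eq_zero (.of_forall fun s ↦ ?_)
    rw [Real.smoothTransition.zero_of_nonpos h0]
    exact Real.smoothTransition.nonneg s
  · refine IsLocalMax.deriv_eq_zero (.of_forall fun s ↦ ?_)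
    rw [Real.smoothTransition.one_of_one_le (not_lt.1 fun h1 ↦ ht ⟨h0, h1⟩)]
    exact Real.smoothTransition.le_one s

theorem exists_norm_mul_deriv_smoothTransition_le :
    ∃ C : ℝ, ∀ t, ‖t * deriv Real.smoothTransition t‖ ≤ C := by
  have hσ : Continuous (deriv Real.smoothTransition) :=
    (Real.smoothTransition.contDiff (n := 1)).continuous_deriv le_rfl
  have hc : HasCompactSupport fun t ↦ t * deriv Real.smoothTransition t :=
    .intro (K := Icc 0 1) isCompact_Icc fun t ht ↦ by
      rw [deriv_smoothTransition_eq_zero fun h ↦ ht (Ioo_subset_Icc_self h), mul_zero]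
  exact hc.exists_bound_of_continuous (continuous_id.mul hσ)

/-- A smooth function on the line that vanishes for `s ≤ 0` and equals `s` for `s ≥ 1 / k`: a
regularization of the positive part whose derivative is bounded uniformly in `k`. -/
def smoothPosPart (k : ℕ) (s : ℝ) : ℝ := s * Real.smoothTransition (k * s)

theorem contDiff_smoothPosPart (k : ℕ) : ContDiff ℝ 1 (smoothPosPart k) :=
  contDiff_id.mul (Real.smoothTransition.contDiff.comp (contDiff_const.mul contDiff_id))

theorem deriv_smoothPosPart (k : ℕ) (s : ℝ) : deriv (smoothPosPart k) s =
    Real.smoothTransition (k * s) + k * s * deriv Real.smoothTransition (k * s) := by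
  have hσ := (Real.smoothTransition.contDiff (n := 1)).differentiable (by simp) (k * s)
  have h := (hasDerivAt_id s).mul (hσ.hasDerivAt.comp s ((hasDerivAt_id s).const_mul (k : ℝ)))
  refine h.deriv.trans ?_
  simp only [id_eq, Function.comp_apply]
  ring

theorem exists_norm_deriv_smoothPosPart_le :
    ∃ C : ℝ≥0, ∀ k s, ‖deriv (smoothPosPart k) s‖ ≤ C := by
  obtain ⟨C, hC⟩ := exists_norm_mul_deriv_smoothTransition_le
  refine ⟨(1 + C).toNNReal, fun k s ↦ le_trans ?_ (Real.le_coe_toNNReal _)⟩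
  rw [deriv_smoothPosPart]
  refine norm_add_le_of_le ?_ (hC _)
  rw [Real.norm_of_nonneg (Real.smoothTransition.nonneg _)]
  exact Real.smoothTransition.le_one _

theorem norm_smoothPosPart_le (k : ℕ) (s : ℝ) : ‖smoothPosPart k s‖ ≤ ‖s‖ := by
  rw [smoothPosPart, norm_mul, Real.norm_of_nonneg (Real.smoothTransition.nonneg _)]
  exact mul_le_of_le_one_right (norm_nonneg _) (Real.smoothTransition.le_one _)

theorem eventually_smoothPosPart_eq (s : ℝ) : ∀ᶠ k in atTop, smoothPosPart k s = max s 0 := by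
  rcases le_or_gt s 0 with hs | hs
  · refine .of_forall fun k ↦ ?_
    rw [smoothPosPart, max_eq_right hs,
      Real.smoothTransition.zero_of_nonpos (mul_nonpos_of_nonneg_of_nonpos k.cast_nonneg hs),
      mul_zero]
  · filter_upwards [(tendsto_natCast_atTop_atTop.atTop_mul_const hs).eventually_ge_atTop 1]
      with k hk
    rw [smoothPosPart, max_eq_left hs.le, Real.smoothTransition.one_of_one_le hk, mul_one]

theorem eventually_deriv_smoothPosPart_eq (s : ℝ) :
    ∀ᶠ k in atTop, deriv (smoothPosPart k) s = if 0 < s then 1 else 0 := by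
  rcases le_or_gt s 0 with hs | hs
  · refine .of_forall fun k ↦ ?_
    have hks : (k : ℝ) * s ≤ 0 := mul_nonpos_of_nonneg_of_nonpos k.cast_nonneg hs
    rw [deriv_smoothPosPart, Real.smoothTransition.zero_of_nonpos hks,
      deriv_smoothTransition_eq_zero fun h ↦ h.1.not_ge hks, if_neg hs.not_gt, mul_zero, add_zero]
  · filter_upwards [(tendsto_natCast_atTop_atTop.atTop_mul_const hs).eventually_ge_atTop 1]
      with k hk
    rw [deriv_smoothPosPart, Real.smoothTransition.one_of_one_le hk,
      deriv_smoothTransition_eq_zero fun h ↦ h.2.not_ge hk, if_pos hs, mul_zero, add_zero]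

theorem lipschitzWith_mul_of_norm_le {X : Type*} [PseudoMetricSpace X] {f g : X → ℝ}
    {C D M N : ℝ≥0} (hf : LipschitzWith C f) (hg : LipschitzWith D g) (hM : ∀ x, ‖f x‖ ≤ M)
    (hN : ∀ x, ‖g x‖ ≤ N) : LipschitzWith (M * D + N * C) fun x ↦ f x * g x := by
  refine .of_dist_le_mul fun x y ↦ ?_
  calc dist (f x * g x) (f y * g y)
      = ‖f x * (g x - g y) + g y * (f x - f y)‖ := by rw [dist_eq_norm]; ring_nf
    _ ≤ ‖f x‖ * ‖g x - g y‖ + ‖g y‖ * ‖f x - f y‖ := by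
      simpa only [norm_mul] using norm_add_le (f x * (g x - g y)) (g y * (f x - f y))
    _ ≤ M * (D * dist x y) + N * (C * dist x y) := by
      gcongr
      exacts [hM x, dist_eq_norm (g x) (g y) ▸ hg.dist_le_mul x y, hN y,
        dist_eq_norm (f x) (f y) ▸ hf.dist_le_mul x y]
    _ = ((M * D + N * C : ℝ≥0) : ℝ) * dist x y := by push_cast; ring

namespace MemSobolevLoc

variable {u : EuclideanSpace ℝ (Fin d) → ℝ}
  {g : EuclideanSpace ℝ (Fin d) → EuclideanSpace ℝ (Fin d)}

theorem comp (hu : MemSobolevLoc u g) {Φ : ℝ → ℝ} (hΦ : ContDiff ℝ 1 Φ) {C : ℝ≥0}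
    (hC : ∀ s, ‖deriv Φ s‖ ≤ C) :
    MemSobolevLoc (fun x ↦ Φ (u x)) fun x ↦ deriv Φ (u x) • g x := by
  have hΦlip : LipschitzWith C Φ :=
    lipschitzWith_of_nnnorm_deriv_le (hΦ.differentiable (by simp)) hC
  have hΦ' : Continuous (deriv Φ) := hΦ.continuous_deriv le_rfl
  have hU : ∀ n, ContDiff ℝ ∞ (mollify n u) := fun n ↦ contDiff_mollify n hu.locallyIntegrable
  have hΦU : ∀ n, MemSobolevLoc (fun x ↦ Φ (mollify n u x))
      fun x ↦ deriv Φ (mollify n u x) • mollify n g x := fun n ↦ by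
    have hcomp : ContDiff ℝ 1 fun x ↦ Φ (mollify n u x) := hΦ.comp ((hU n).of_le (by simp))
    refine (memSobolevLoc_of_contDiff hcomp).congr .rfl (.of_forall fun x ↦ ?_)
    rw [gradient_comp (hΦ.differentiable (by simp) _) ((hU n).differentiable (by simp) x),
      hu.gradient_mollify]
  have hg : LocallyIntegrable fun x ↦ deriv Φ (u x) • g x :=
    locallyIntegrable_of_norm_le_const_mul hu.locallyIntegrable_grad
      ((hΦ'.comp_aestronglyMeasurable hu.locallyIntegrable.aestronglyMeasurable).smul
        hu.locallyIntegrable_grad.aestronglyMeasurable) fun x ↦ by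
        rw [norm_smul]
        exact mul_le_mul_of_nonneg_right (hC _) (norm_nonneg _)
  refine .of_tendstoInL1Loc hΦU
    (locallyIntegrable_comp_lipschitzWith hΦlip hu.locallyIntegrable) hg
    ((tendstoInL1Loc_mollify hu.locallyIntegrable).comp_lipschitzWith hΦlip)
    (.bdd_smul (C := C) (fun n ↦ (hΦ'.comp (hU n).continuous).aestronglyMeasurable)
      (fun n x ↦ hC _) ?_ hu.locallyIntegrable_grad
      (tendstoInL1Loc_mollify hu.locallyIntegrable_grad))
  filter_upwards [ae_tendsto_mollify hu.locallyIntegrable] with x hx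
  exact (hΦ'.tendsto _).comp hx

theorem max_zero (hu : MemSobolevLoc u g) :
    MemSobolevLoc (fun x ↦ max (u x) 0) (indicator {x | 0 < u x} g) := by
  obtain ⟨C, hC⟩ := exists_norm_deriv_smoothPosPart_le
  have hk := fun k ↦ hu.comp (contDiff_smoothPosPart k) (hC k)
  have hu' : LocallyIntegrable fun x ↦ max (u x) 0 :=
    locallyIntegrable_comp_lipschitzWith (LipschitzWith.id.max_const 0) hu.locallyIntegrable
  have hg' : LocallyIntegrable (indicator {x | 0 < u x} g) :=
    hu.locallyIntegrable_grad.mono (hu.locallyIntegrable_grad.aestronglyMeasurable.indicator₀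
      (nullMeasurableSet_lt aemeasurable_const
        hu.locallyIntegrable.aestronglyMeasurable.aemeasurable))
      (.of_forall fun x ↦ norm_indicator_le_norm_self _ _)
  have hun := locallyIntegrable_comp_lipschitzWith lipschitzWith_one_norm hu.locallyIntegrable
  have hgn := locallyIntegrable_comp_lipschitzWith lipschitzWith_one_norm hu.locallyIntegrable_grad
  refine .of_tendstoInL1Loc hk hu' hg'
    (.of_dominated (fun k ↦ (hk k).locallyIntegrable.aestronglyMeasurable) hun
      (fun k ↦ .of_forall fun x ↦ norm_smoothPosPart_le k (u x))
      (.of_forall fun x ↦ tendsto_const_nhds.congr' ?_))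
    (.of_dominated (fun k ↦ (hk k).locallyIntegrable_grad.aestronglyMeasurable)
      (hgn.smul (C : ℝ)) (fun k ↦ .of_forall fun x ↦ ?_)
      (.of_forall fun x ↦ tendsto_const_nhds.congr' ?_))
  · exact (eventually_smoothPosPart_eq (u x)).mono fun k hk ↦ hk.symm
  · rw [norm_smul]
    exact mul_le_mul_of_nonneg_right (hC k _) (norm_nonneg _)
  · filter_upwards [eventually_deriv_smoothPosPart_eq (u x)] with k hk
    rw [hk, ite_smul, one_smul, zero_smul]
    rfl

protected theorem max (hu : MemSobolevLoc u g) (hv : MemSobolevLoc v h) :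
    MemSobolevLoc (fun x ↦ max (u x) (v x)) fun x ↦ if u x < v x then h x else g x := by
  refine (hu.add (hv.sub hu).max_zero).congr (.of_forall fun x ↦ ?_) (.of_forall fun x ↦ ?_)
  · rcases le_total (u x) (v x) with hx | hx <;> simp [hx]
  · by_cases hx : u x < v x <;> simp [indicator, hx]

protected theorem min (hu : MemSobolevLoc u g) (hv : MemSobolevLoc v h) :
    MemSobolevLoc (fun x ↦ min (u x) (v x)) fun x ↦ if u x < v x then g x else h x := by
  refine (hv.sub (hv.sub hu).max_zero).congr (.of_forall fun x ↦ ?_) (.of_forall fun x ↦ ?_)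
  · rcases le_total (u x) (v x) with hx | hx <;> simp [hx]
  · by_cases hx : u x < v x <;> simp [indicator, hx]

theorem lintegral_enorm_max_add_lintegral_enorm_min (hu : MemSobolevLoc u g)
    (hv : MemSobolevLoc v h) :
    (∫⁻ x, ‖if u x < v x then h x else g x‖ₑ) + ∫⁻ x, ‖if u x < v x then g x else h x‖ₑ =
      (∫⁻ x, ‖g x‖ₑ) + ∫⁻ x, ‖h x‖ₑ := by
  rw [← lintegral_add_left' (hu.max hv).locallyIntegrable_grad.aestronglyMeasurable.enorm,
    ← lintegral_add_left' hu.locallyIntegrable_grad.aestronglyMeasurable.enorm]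
  congr with x
  split_ifs
  · exact add_comm _ _
  · rfl

theorem ae_eq_zero_of_eq_zero (hu : MemSobolevLoc u g) : ∀ᵐ x, u x = 0 → g x = 0 := by
  have huv : ∀ x, max (u x) 0 - max (-u x) 0 = u x := fun x ↦ by
    rcases le_total 0 (u x) with h | h <;> simp [h]
  have hpn := (hu.max_zero.sub hu.neg.max_zero).congr (.of_forall huv) .rfl
  filter_upwards [hu.ae_eq hpn] with x hx h0
  rw [hx, indicator_of_notMem, indicator_of_notMem, sub_zero] <;> simp [h0]

theorem exists_ae_eq_const (hu : MemSobolevLoc u fun _ ↦ 0) : ∃ c, ∀ᵐ x, u x = c := by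
  have hconst : ∀ n x y, mollify n u x = mollify n u y := fun n x y ↦ by
    refine is_const_of_fderiv_eq_zero (𝕜 := ℝ)
      ((contDiff_mollify n hu.locallyIntegrable).differentiable (by simp)) (fun z ↦ ?_) x y
    ext v
    rw [← inner_gradient_left, hu.gradient_mollify]
    simp [mollify_apply]
  have hlim := ae_tendsto_mollify hu.locallyIntegrable
  obtain ⟨y, hy⟩ := hlim.exists
  refine ⟨u y, ?_⟩
  filter_upwards [hlim] with x hx
  exact tendsto_nhds_unique hx (hy.congr fun n ↦ hconst n y x)

theorem lipschitz_mul (hu : MemSobolevLoc u g) {C M : ℝ≥0} {a : ℝᵈ → ℝ}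
    (ha : LipschitzWith C a) (hM : ∀ x, ‖a x‖ ≤ M) :
    MemSobolevLoc (fun x ↦ a x * u x) fun x ↦ a x • g x + u x • gradient a x := by
  have ham := ha.continuous.aestronglyMeasurable (μ := volume)
  have hau := locallyIntegrable_bdd_smul hu.locallyIntegrable ham hM
  have hag := locallyIntegrable_bdd_smul hu.locallyIntegrable_grad ham hM
  have hua := locallyIntegrable_smul_gradient hu.locallyIntegrable ha
  refine ⟨hau, hag.add hua, fun φ hφ hc i ↦ ?_⟩
  obtain ⟨D, hD⟩ := ContDiff.lipschitzWith_of_hasCompactSupport hc hφ (by simp)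
  obtain ⟨N, hN⟩ := hc.exists_bound_of_continuous hφ.continuous
  have hN' : ∀ x, ‖φ x‖ ≤ N.toNNReal := fun x ↦ (hN x).trans (Real.le_coe_toNNReal N)
  have htest := hu.integral_mul_gradient (lipschitzWith_mul_of_norm_le ha hD hM hN') hc.mul_left i
  have hgrad : (fun x ↦ u x * gradient (fun x ↦ a x * φ x) x i) =ᵐ[volume]
      fun x ↦ a x * u x * fderiv ℝ φ x (EuclideanSpace.single i 1) +
        (u x • gradient a x) i * φ x := by
    filter_upwards [ha.ae_differentiableAt (μ := volume)] with x hx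
    rw [gradient_mul hx (hφ.differentiable (by simp) x), PiLp.add_apply, PiLp.smul_apply,
      gradient_apply φ]
    simp only [PiLp.smul_apply, smul_eq_mul]
    ring
  have hφi : Integrable fun x ↦ a x * u x * fderiv ℝ φ x (EuclideanSpace.single i 1) :=
    hau.integrable_smul_right_of_hasCompactSupport
      ((hφ.continuous_fderiv (by simp)).clm_apply continuous_const) (hc.fderiv_apply (𝕜 := ℝ) _)
  have hi : Integrable fun x ↦ (a x • g x) i * φ x :=
    (locallyIntegrable_coord hag i).integrable_smul_right_of_hasCompactSupport hφ.continuous hc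
  have hi' : Integrable fun x ↦ (u x • gradient a x) i * φ x :=
    (locallyIntegrable_coord hua i).integrable_smul_right_of_hasCompactSupport hφ.continuous hc
  rw [integral_congr_ae hgrad, integral_add hφi hi'] at htest
  simp only [PiLp.add_apply, add_mul]
  rw [integral_add hi hi']
  simp only [PiLp.smul_apply, smul_eq_mul, mul_assoc, mul_left_comm] at htest ⊢
  linarith

end MemSobolevLoc

end ChainRule

/-! ### Perimeter -/

section TestField

/-- The competitors `T ∈ C¹_c(ℝ^d; ℝ^d)`, `|T| ≤ 1`, in De Giorgi's definition of the perimeter. -/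
structure IsTestField (T : ℝᵈ → ℝᵈ) : Prop where
  contDiff : ContDiff ℝ 1 T
  hasCompactSupport : HasCompactSupport T
  norm_le_one : ∀ x, ‖T x‖ ≤ 1

variable {T : EuclideanSpace ℝ (Fin d) → EuclideanSpace ℝ (Fin d)}

theorem contDiff_coord {n : WithTop ℕ∞} (hT : ContDiff ℝ n T) (i : Fin d) :
    ContDiff ℝ n fun x ↦ T x i :=
  (EuclideanSpace.proj i : ℝᵈ →L[ℝ] ℝ).contDiff.comp hT

theorem hasCompactSupport_coord (hc : HasCompactSupport T) (i : Fin d) :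
    HasCompactSupport fun x ↦ T x i :=
  hc.comp_left (g := fun v : ℝᵈ ↦ v i) (by simp)

theorem divergence_eq_sum_fderiv_coord (hT : ContDiff ℝ 1 T) (x : ℝᵈ) :
    divergence T x = ∑ i, fderiv ℝ (fun y ↦ T y i) x (EuclideanSpace.single i 1) := by
  refine Finset.sum_congr rfl fun i _ ↦ ?_
  have hcoord : HasFDerivAt (fun y ↦ T y i) _ x := (EuclideanSpace.proj i : ℝᵈ →L[ℝ] ℝ).hasFDerivAt
    |>.comp x (hT.differentiable (by simp) x).hasFDerivAt
  rw [hcoord.fderiv]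
  simp

theorem continuous_fderiv_coord_apply (hT : ContDiff ℝ 1 T) (i : Fin d) :
    Continuous fun x ↦ fderiv ℝ (fun y ↦ T y i) x (EuclideanSpace.single i 1) :=
  ((contDiff_coord hT i).continuous_fderiv (by simp)).clm_apply continuous_const

theorem continuous_divergence (hT : ContDiff ℝ 1 T) : Continuous (divergence T) := by
  simp only [funext (divergence_eq_sum_fderiv_coord hT)]
  exact continuous_finsetSum _ fun i _ ↦ continuous_fderiv_coord_apply hT i

theorem hasCompactSupport_divergence (hc : HasCompactSupport T) :
    HasCompactSupport (divergence T) :=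
  (hc.fderiv (𝕜 := ℝ)).comp_left
    (g := fun L : ℝᵈ →L[ℝ] ℝᵈ ↦ ∑ i : Fin d, (L (EuclideanSpace.single i 1)) i) (by simp)

theorem divergence_mollify (n : ℕ) (hT : ContDiff ℝ 1 T) :
    divergence (mollify n T) = mollify n (divergence T) := by
  ext x
  have hTi : LocallyIntegrable T := hT.continuous.locallyIntegrable
  have hcoord : ∀ i, fderiv ℝ (fun y ↦ mollify n T y i) x (EuclideanSpace.single i 1) =
      mollify n (fun y ↦ fderiv ℝ (fun z ↦ T z i) y (EuclideanSpace.single i 1)) x := fun i ↦ by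
    have hTc := memSobolevLoc_of_contDiff (contDiff_coord hT i)
    simp only [mollify_coord hTi, ← gradient_apply, hTc.gradient_mollify,
      mollify_coord hTc.locallyIntegrable_grad]
  rw [divergence_eq_sum_fderiv_coord ((contDiff_mollify n hTi).of_le (by simp))]
  simp only [hcoord]
  simp only [mollify_apply, divergence_eq_sum_fderiv_coord hT, Finset.smul_sum]
  exact (integral_finsetSum _ fun i _ ↦ integrable_mollifier_smul n
    (continuous_fderiv_coord_apply hT i).locallyIntegrable x).symm

theorem MemSobolevLoc.integral_mul_divergence {u : ℝᵈ → ℝ} {g : ℝᵈ → ℝᵈ}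
    (hu : MemSobolevLoc u g) (hT : ContDiff ℝ 1 T) (hc : HasCompactSupport T) :
    ∫ x, u x * divergence T x = -∫ x, inner ℝ (g x) (T x) := by
  have hinner : ∀ x, inner ℝ (g x) (T x) = ∑ i, g x i * T x i := fun x ↦ by
    simp [PiLp.inner_apply, mul_comm]
  simp only [divergence_eq_sum_fderiv_coord hT, Finset.mul_sum, hinner]
  rw [integral_finsetSum _ fun i _ ↦ hu.integrable_mul_fderiv (contDiff_coord hT i)
      (hasCompactSupport_coord hc i) i,
    integral_finsetSum _ fun i _ ↦ hu.integrable_coord_mul (contDiff_coord hT i).continuous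
      (hasCompactSupport_coord hc i) i, ← Finset.sum_neg_distrib]
  exact Finset.sum_congr rfl fun i _ ↦
    hu.integral_mul_fderiv (contDiff_coord hT i) (hasCompactSupport_coord hc i) i

theorem isTestField_mollify (n : ℕ) (hT : LocallyIntegrable T) (hc : HasCompactSupport T)
    (h1 : ∀ x, ‖T x‖ ≤ 1) : IsTestField (mollify n T) :=
  ⟨(contDiff_mollify n hT).of_le (by simp), hasCompactSupport_mollify n hc, norm_mollify_le n h1⟩

namespace IsTestField

theorem integrable_divergence (hT : IsTestField T) : Integrable (divergence T) :=
  (continuous_divergence hT.contDiff).integrable_of_hasCompactSupport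
    (hasCompactSupport_divergence hT.hasCompactSupport)

theorem neg (hT : IsTestField T) : IsTestField fun x ↦ -T x :=
  ⟨hT.contDiff.neg, hT.hasCompactSupport.neg, fun x ↦ by simpa using hT.norm_le_one x⟩

theorem comp_sub_right (hT : IsTestField T) (a : ℝᵈ) : IsTestField fun x ↦ T (x - a) :=
  ⟨hT.contDiff.comp (contDiff_id.sub contDiff_const),
    hT.hasCompactSupport.comp_homeomorph (Homeomorph.subRight a), fun _ ↦ hT.norm_le_one _⟩

theorem tendsto_integral_mul_divergence (hT : IsTestField T) {u : ℕ → ℝᵈ → ℝ} {v : ℝᵈ → ℝ} {C : ℝ}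
    (hu : ∀ n, AEStronglyMeasurable (u n) volume) (hC : ∀ n x, ‖u n x‖ ≤ C)
    (huv : ∀ᵐ x, Tendsto (fun n ↦ u n x) atTop (𝓝 (v x))) :
    Tendsto (fun n ↦ ∫ x, u n x * divergence T x) atTop (𝓝 (∫ x, v x * divergence T x)) := by
  refine tendsto_integral_of_dominated_convergence (fun x ↦ C * ‖divergence T x‖)
    (fun n ↦ (hu n).mul hT.integrable_divergence.aestronglyMeasurable)
    (hT.integrable_divergence.norm.const_mul C) (fun n ↦ .of_forall fun x ↦ ?_) ?_
  · rw [norm_mul]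
    exact mul_le_mul_of_nonneg_right (hC n x) (norm_nonneg _)
  · filter_upwards [huv] with x hx using hx.mul_const _

theorem ofReal_integral_mul_divergence_le (hT : IsTestField T) {u : ℝᵈ → ℝ} {g : ℝᵈ → ℝᵈ}
    (hu : MemSobolevLoc u g) :
    ENNReal.ofReal (∫ x, u x * divergence T x) ≤ ∫⁻ x, ‖g x‖ₑ := by
  rw [hu.integral_mul_divergence hT.contDiff hT.hasCompactSupport, ← integral_neg]
  calc ENNReal.ofReal (∫ x, -inner ℝ (g x) (T x))
      ≤ ‖∫ x, -inner ℝ (g x) (T x)‖ₑ := Real.ofReal_le_enorm _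
    _ ≤ ∫⁻ x, ‖-inner ℝ (g x) (T x)‖ₑ := enorm_integral_le_lintegral_enorm _
    _ ≤ ∫⁻ x, ‖g x‖ₑ := lintegral_mono fun x ↦ by
        rw [enorm_neg]
        refine enorm_le_iff_norm_le.2 ((norm_inner_le_norm _ _).trans ?_)
        exact mul_le_of_le_one_right (norm_nonneg _) (hT.norm_le_one x)

end IsTestField

end TestField

section Perimeter

theorem perimeter_eq_iSup_isTestField (A : Set ℝᵈ) : perimeter A =
    ⨆ (T : ℝᵈ → ℝᵈ) (_ : IsTestField T), ENNReal.ofReal (∫ x in A, divergence T x) :=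
  iSup_congr fun _ ↦ le_antisymm
    (iSup₂_le fun hT hc ↦ iSup_le fun h1 ↦ le_iSup_of_le ⟨hT, hc, h1⟩ le_rfl)
    (iSup_le fun hT ↦ le_iSup₂_of_le hT.contDiff hT.hasCompactSupport <|
      le_iSup_of_le hT.norm_le_one le_rfl)

theorem IsTestField.ofReal_setIntegral_divergence_le {T : ℝᵈ → ℝᵈ} (hT : IsTestField T)
    (A : Set ℝᵈ) : ENNReal.ofReal (∫ x in A, divergence T x) ≤ perimeter A := by
  rw [perimeter_eq_iSup_isTestField]
  exact le_iSup₂_of_le T hT le_rfl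

theorem perimeter_le {A : Set ℝᵈ} {c : ℝ≥0∞} (h : ∀ T : ℝᵈ → ℝᵈ, IsTestField T →
    ENNReal.ofReal (∫ x in A, divergence T x) ≤ c) : perimeter A ≤ c := by
  rw [perimeter_eq_iSup_isTestField]
  exact iSup₂_le h

theorem perimeter_congr {A B : Set ℝᵈ} (h : A =ᵐ[volume] B) : perimeter A = perimeter B := by
  simp only [perimeter, setIntegral_congr_set h]

theorem perimeter_preimage_add_right_le (A : Set ℝᵈ) (a : ℝᵈ) :
    perimeter ((· + a) ⁻¹' A) ≤ perimeter A := by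
  refine perimeter_le fun T hT ↦ ?_
  have hdiv : ∀ x, divergence (fun y ↦ T (y - a)) (x + a) = divergence T x := fun x ↦ by
    simp only [divergence, fderiv_comp_sub, add_sub_cancel_right]
  have hint := (measurePreserving_add_right volume a).setIntegral_preimage_emb
    (measurableEmbedding_addRight a) (divergence fun y ↦ T (y - a)) A
  simp only [hdiv] at hint
  rw [hint]
  exact (hT.comp_sub_right a).ofReal_setIntegral_divergence_le A

theorem perimeter_preimage_add_right (A : Set ℝᵈ) (a : ℝᵈ) :
    perimeter ((· + a) ⁻¹' A) = perimeter A := by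
  refine le_antisymm (perimeter_preimage_add_right_le A a) ?_
  simpa [preimage_preimage] using perimeter_preimage_add_right_le ((· + a) ⁻¹' A) (-a)

theorem integral_indicator_one_mul {A : Set ℝᵈ} (hA : MeasurableSet A) (f : ℝᵈ → ℝ) :
    ∫ x, A.indicator (fun _ ↦ (1 : ℝ)) x * f x = ∫ x in A, f x := by
  rw [← integral_indicator hA]
  congr with x
  by_cases hx : x ∈ A <;> simp [hx]

theorem perimeter_le_liminf_lintegral_enorm {u : ℕ → ℝᵈ → ℝ} {g : ℕ → ℝᵈ → ℝᵈ} {C : ℝ} {A : Set ℝᵈ}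
    (hA : MeasurableSet A) (hu : ∀ n, MemSobolevLoc (u n) (g n)) (hC : ∀ n x, ‖u n x‖ ≤ C)
    (hlim : ∀ᵐ x, Tendsto (fun n ↦ u n x) atTop (𝓝 (A.indicator (fun _ ↦ 1) x))) :
    perimeter A ≤ liminf (fun n ↦ ∫⁻ x, ‖g n x‖ₑ) atTop := by
  refine perimeter_le fun T hT ↦ ?_
  have hint := ENNReal.tendsto_ofReal (hT.tendsto_integral_mul_divergence
    (fun n ↦ (hu n).locallyIntegrable.aestronglyMeasurable) hC hlim)
  rw [integral_indicator_one_mul hA] at hint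
  rw [← hint.liminf_eq]
  exact liminf_le_liminf (.of_forall fun n ↦ hT.ofReal_integral_mul_divergence_le (hu n))

theorem lintegral_enorm_le_of_forall_integral_inner_le {G : ℝᵈ → ℝᵈ} (hG : LocallyIntegrable G)
    {c : ℝ≥0∞} (h : ∀ T : ℝᵈ → ℝᵈ, IsTestField T →
      ENNReal.ofReal (∫ x, inner ℝ (G x) (T x)) ≤ c) : ∫⁻ x, ‖G x‖ₑ ≤ c := by
  have hcover : AECover volume atTop fun n : ℕ ↦ closedBall (0 : ℝᵈ) n :=
    aecover_closedBall tendsto_natCast_atTop_atTop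
  refine le_of_tendsto' (hcover.lintegral_tendsto_of_countably_generated
    hG.aestronglyMeasurable.enorm) fun k ↦ ?_
  have hK : IsCompact (closedBall (0 : ℝᵈ) k) := isCompact_closedBall _ _
  set N : ℝᵈ → ℝᵈ := (closedBall 0 k).indicator fun x ↦ ‖G x‖⁻¹ • G x
  have hN1 : ∀ x, ‖N x‖ ≤ 1 := fun x ↦ (norm_indicator_le_norm_self _ x).trans <| by
    rw [norm_smul, norm_inv, norm_norm]
    exact inv_mul_le_one
  have hNK : Function.support N ⊆ closedBall 0 k := support_indicator_subset
  have hNc : HasCompactSupport N := .of_support_subset_isCompact hK hNK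
  have hN : LocallyIntegrable N := (memLp_top_of_bound
    ((hG.aestronglyMeasurable.norm.aemeasurable.inv.aestronglyMeasurable.smul
      hG.aestronglyMeasurable).indicator measurableSet_closedBall) 1
    (.of_forall hN1)).locallyIntegrable le_top
  have hlim := tendsto_integral_inner_mollify hG hN hN1 hK hNK
  have hGN : ∫ x, inner ℝ (G x) (N x) = ∫ x in closedBall 0 (k : ℝ), ‖G x‖ := by
    rw [← integral_indicator measurableSet_closedBall]
    congr with x
    by_cases hx : x ∈ closedBall (0 : ℝᵈ) k
    · simp only [N, indicator_of_mem hx, real_inner_smul_right, real_inner_self_eq_norm_mul_norm,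
        ← mul_assoc, inv_mul_mul_self]
    · simp [N, indicator_of_notMem hx]
  rw [← ofReal_integral_norm_eq_lintegral_enorm (hG.integrableOn_isCompact hK), ← hGN]
  exact le_of_tendsto' (ENNReal.tendsto_ofReal hlim) fun n ↦ h _ (isTestField_mollify n hN hNc hN1)

theorem lintegral_enorm_gradient_mollify_indicator_le {A : Set ℝᵈ} (hA : MeasurableSet A) (n : ℕ) :
    ∫⁻ x, ‖gradient (mollify n (A.indicator fun _ ↦ (1 : ℝ))) x‖ₑ ≤ perimeter A := by
  have hi : LocallyIntegrable (A.indicator fun _ ↦ (1 : ℝ)) :=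
    (locallyIntegrable_const (1 : ℝ)).indicator hA
  have hu := memSobolevLoc_of_contDiff (f := mollify n (A.indicator fun _ ↦ (1 : ℝ)))
    ((contDiff_mollify n hi).of_le (by simp))
  refine lintegral_enorm_le_of_forall_integral_inner_le hu.locallyIntegrable_grad fun T hT ↦ ?_
  have hT' := hT.neg
  have hpair := hu.integral_mul_divergence hT'.contDiff hT'.hasCompactSupport
  simp only [inner_neg_right, integral_neg, neg_neg] at hpair
  rw [← hpair, integral_mollify_mul_of_hasCompactSupport n hi hT'.integrable_divergence
      (hasCompactSupport_divergence hT'.hasCompactSupport), integral_indicator_one_mul hA,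
    ← divergence_mollify n hT'.contDiff]
  exact (isTestField_mollify n hT'.contDiff.continuous.locallyIntegrable hT'.hasCompactSupport
    hT'.norm_le_one).ofReal_setIntegral_divergence_le A

theorem liminf_add_liminf_le (u v : ℕ → ℝ≥0∞) :
    liminf u atTop + liminf v atTop ≤ liminf (fun n ↦ u n + v n) atTop := by
  simp only [liminf_eq_iSup_iInf_of_nat]
  rw [ENNReal.iSup_add_iSup_of_monotone
    (fun _ _ h ↦ biInf_mono fun _ ↦ h.trans) (fun _ _ h ↦ biInf_mono fun _ ↦ h.trans)]
  exact iSup_mono fun n ↦ le_iInf₂ fun i hi ↦ add_le_add (iInf₂_le i hi) (iInf₂_le i hi)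

theorem perimeter_union_add_perimeter_inter_le_of_measurableSet {A B : Set ℝᵈ}
    (hA : MeasurableSet A) (hB : MeasurableSet B) :
    perimeter (A ∪ B) + perimeter (A ∩ B) ≤ perimeter A + perimeter B := by
  set u : Set ℝᵈ → ℕ → ℝᵈ → ℝ := fun D n ↦ mollify n (D.indicator fun _ ↦ 1)
  have hi {D : Set ℝᵈ} (hD : MeasurableSet D) : LocallyIntegrable (D.indicator fun _ ↦ (1 : ℝ)) :=
    (locallyIntegrable_const (1 : ℝ)).indicator hD
  have hu {D : Set ℝᵈ} (hD : MeasurableSet D) (n : ℕ) : MemSobolevLoc (u D n) (gradient (u D n)) :=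
    memSobolevLoc_of_contDiff ((contDiff_mollify n (hi hD)).of_le (by simp))
  have hlim {D : Set ℝᵈ} (hD : MeasurableSet D) :
      ∀ᵐ x, Tendsto (fun n ↦ u D n x) atTop (𝓝 (D.indicator (fun _ ↦ 1) x)) :=
    ae_tendsto_mollify (hi hD)
  have hu1 (D : Set ℝᵈ) (n : ℕ) (x : ℝᵈ) : |u D n x| ≤ 1 := by
    refine norm_mollify_le n (f := D.indicator fun _ ↦ (1 : ℝ)) (fun y ↦ ?_) x
    by_cases hy : y ∈ D <;> simp [hy]
  have hUnion : perimeter (A ∪ B) ≤ _ :=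
    perimeter_le_liminf_lintegral_enorm (C := 1) (hA.union hB) (fun n ↦ (hu hA n).max (hu hB n))
      (fun n x ↦ abs_max_le_max_abs_abs.trans (max_le (hu1 A n x) (hu1 B n x))) <| by
        filter_upwards [hlim hA, hlim hB] with x hxA hxB
        convert hxA.max hxB using 2
        by_cases h1 : x ∈ A <;> by_cases h2 : x ∈ B <;> simp [h1, h2]
  have hInter : perimeter (A ∩ B) ≤ _ :=
    perimeter_le_liminf_lintegral_enorm (C := 1) (hA.inter hB) (fun n ↦ (hu hA n).min (hu hB n))
      (fun n x ↦ abs_min_le_max_abs_abs.trans (max_le (hu1 A n x) (hu1 B n x))) <| by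
        filter_upwards [hlim hA, hlim hB] with x hxA hxB
        convert hxA.min hxB using 2
        by_cases h1 : x ∈ A <;> by_cases h2 : x ∈ B <;> simp [h1, h2]
  calc perimeter (A ∪ B) + perimeter (A ∩ B) ≤ _ :=
        (add_le_add hUnion hInter).trans (liminf_add_liminf_le _ _)
    _ ≤ liminf (fun _ : ℕ ↦ perimeter A + perimeter B) atTop :=
        liminf_le_liminf <| .of_forall fun n ↦ by
          rw [(hu hA n).lintegral_enorm_max_add_lintegral_enorm_min (hu hB n)]
          exact add_le_add (lintegral_enorm_gradient_mollify_indicator_le hA n)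
            (lintegral_enorm_gradient_mollify_indicator_le hB n)
    _ = perimeter A + perimeter B := liminf_const _

theorem perimeter_union_add_perimeter_inter_le {A B : Set ℝᵈ} (hA : NullMeasurableSet A)
    (hB : NullMeasurableSet B) :
    perimeter (A ∪ B) + perimeter (A ∩ B) ≤ perimeter A + perimeter B := by
  have hA' := hA.toMeasurable_ae_eq
  have hB' := hB.toMeasurable_ae_eq
  rw [← perimeter_congr hA', ← perimeter_congr hB', ← perimeter_congr (hA'.union hB'),
    ← perimeter_congr (hA'.inter hB')]
  exact perimeter_union_add_perimeter_inter_le_of_measurableSet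
    (measurableSet_toMeasurable _ _) (measurableSet_toMeasurable _ _)

end Perimeter

section DecreasesPerimeter

/-- Intersecting with `A` does not increase the perimeter of sets of finite measure. This is the
part of the supersolution property which is inherited by inner parallel sets. -/
def DecreasesPerimeter (A : Set ℝᵈ) : Prop :=
  ∀ B : Set ℝᵈ, MeasurableSet B → volume B ≠ ⊤ → perimeter (B ∩ A) ≤ perimeter B

theorem IsPerimeterSupersolution.decreasesPerimeter {Ω : Set ℝᵈ}
    (h : IsPerimeterSupersolution Ω) : DecreasesPerimeter Ω := by
  intro B hB hBf
  have hsup : perimeter Ω ≤ perimeter (B ∪ Ω) :=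
    h.perimeter_le _ (hB.nullMeasurableSet.union h.nullMeasurableSet) subset_union_right
      (measure_union_lt_top hBf.lt_top h.volume_lt_top)
  refine (ENNReal.add_le_add_iff_left h.perimeter_lt_top.ne).1 ?_
  calc perimeter Ω + perimeter (B ∩ Ω) ≤ perimeter (B ∪ Ω) + perimeter (B ∩ Ω) := by gcongr
    _ ≤ perimeter B + perimeter Ω :=
      perimeter_union_add_perimeter_inter_le hB.nullMeasurableSet h.nullMeasurableSet
    _ = perimeter Ω + perimeter B := add_comm _ _

theorem perimeter_iInter_le {C : ℕ → Set ℝᵈ} (hC : ∀ n, MeasurableSet (C n)) (hanti : Antitone C)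
    {c : ℝ≥0∞} (h : ∀ n, perimeter (C n) ≤ c) : perimeter (⋂ n, C n) ≤ c := by
  refine perimeter_le fun T hT ↦ ?_
  have hlim := tendsto_setIntegral_of_antitone hC hanti ⟨0, hT.integrable_divergence.integrableOn⟩
  exact le_of_tendsto' (ENNReal.tendsto_ofReal hlim) fun n ↦
    (hT.ofReal_setIntegral_divergence_le _).trans (h n)

namespace DecreasesPerimeter

variable {A A' : Set (EuclideanSpace ℝ (Fin d))}

theorem congr (h : DecreasesPerimeter A) (hA : A =ᵐ[volume] A') : DecreasesPerimeter A' :=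
  fun B hB hBf ↦ by
    rw [perimeter_congr ((ae_eq_refl B).inter hA.symm)]
    exact h B hB hBf

theorem preimage_add_right (h : DecreasesPerimeter A) (a : ℝᵈ) :
    DecreasesPerimeter ((· + a) ⁻¹' A) := fun B hB hBf ↦ by
  have e : B ∩ (· + a) ⁻¹' A = (· + a) ⁻¹' ((· + -a) ⁻¹' B ∩ A) := by
    ext x; simp
  rw [e, perimeter_preimage_add_right, ← perimeter_preimage_add_right B (-a)]
  exact h _ (measurable_add_const _ hB) (by rwa [measure_preimage_add_right])

theorem inter (h : DecreasesPerimeter A) (hA : MeasurableSet A) (h' : DecreasesPerimeter A') :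
    DecreasesPerimeter (A ∩ A') := fun B hB hBf ↦ by
  rw [← inter_assoc]
  exact (h' _ (hB.inter hA) (ne_top_of_le_ne_top hBf (measure_mono inter_subset_left))).trans
    (h B hB hBf)

theorem biInter_lt {A : ℕ → Set ℝᵈ} (h : ∀ n, DecreasesPerimeter (A n))
    (hA : ∀ n, MeasurableSet (A n)) (n : ℕ) : DecreasesPerimeter (⋂ k < n, A k) := by
  induction n with
  | zero => exact fun B _ _ ↦ by simp
  | succ n ih =>
    rw [biInter_lt_succ]
    exact ih.inter (.biInter (to_countable _) fun k _ ↦ hA k) (h n)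

theorem iInter {A : ℕ → Set ℝᵈ} (h : ∀ n, DecreasesPerimeter (A n))
    (hA : ∀ n, MeasurableSet (A n)) : DecreasesPerimeter (⋂ n, A n) := by
  intro B hB hBf
  have hC : B ∩ ⋂ n, A n = ⋂ n, B ∩ ⋂ k < n, A k := by
    rw [← inter_iInter, biInter_lt_eq_iInter]
  rw [hC]
  refine perimeter_iInter_le (fun n ↦ hB.inter (.biInter (to_countable _) fun k _ ↦ hA k))
    (fun m n hmn ↦ ?_) fun n ↦ biInter_lt h hA n B hB hBf
  exact inter_subset_inter_right _ (biInter_mono (fun k hk ↦ lt_of_lt_of_le hk hmn) fun _ _ ↦ .rfl)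

end DecreasesPerimeter

end DecreasesPerimeter

/-! ### Inner parallel sets -/

section InnerParallel

theorem le_infDist_support_iff {X : Type*} [PseudoMetricSpace X] [HereditarilyLindelofSpace X]
    [MeasurableSpace X] {μ : Measure X} (h : μ.support.Nonempty) {x : X} {t : ℝ} :
    t ≤ infDist x μ.support ↔ μ (ball x t) = 0 := by
  rw [le_infDist h]
  constructor
  · exact fun hx ↦ measure_mono_null (fun y hy hyμ ↦ (hx hyμ).not_gt (mem_ball'.1 hy))
      Measure.measure_compl_support
  · intro hx y hy
    by_contra! hlt
    exact Measure.subset_compl_support_of_isOpen isOpen_ball hx (mem_ball'.2 hlt) hy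

variable {A : Set (EuclideanSpace ℝ (Fin d))}

theorem tendsto_volume_symmDiff_preimage_add_right (hA : NullMeasurableSet A) (hfin : volume A ≠ ⊤)
    (b : ℝᵈ) : Tendsto (fun c ↦ volume (symmDiff ((· + c) ⁻¹' A) ((· + b) ⁻¹' A)))
      (𝓝 b) (𝓝 0) := by
  let F : C(ℝᵈ, C(ℝᵈ, ℝᵈ)) := ContinuousMap.curry ⟨fun p ↦ p.2 + p.1, by fun_prop⟩
  exact tendsto_measure_symmDiff_preimage_nhds_zero (f := F) (g := F b) (F.continuous.tendsto b)
    (.of_forall fun c ↦ measurePreserving_add_right volume c)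
    (measurePreserving_add_right volume b) hA hfin

theorem volume_iInter_preimage_add_right_diff (hA : NullMeasurableSet A) (hfin : volume A ≠ ⊤)
    {ι : Type*} {a : ι → ℝᵈ} {b : ℝᵈ} (hb : b ∈ closure (range a)) :
    volume ((⋂ n, (· + a n) ⁻¹' A) \ (· + b) ⁻¹' A) = 0 := by
  by_contra hpos
  obtain ⟨_, hlt, n, rfl⟩ := ((mem_closure_iff_frequently.1 hb).and_eventually
    ((tendsto_volume_symmDiff_preimage_add_right hA hfin b).eventually
      (gt_mem_nhds (pos_iff_ne_zero.2 hpos)))).exists.imp fun _ h ↦ h.symm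
  exact hlt.not_ge (measure_mono fun x hx ↦ Or.inl ⟨mem_iInter.1 hx.1 n, hx.2⟩)

theorem ae_volume_ball_diff_eq_zero (hA : MeasurableSet A) (hfin : volume A ≠ ⊤) {t : ℝ}
    {ι : Type*} [Countable ι] {a : ι → ℝᵈ} (ha : ball 0 t ⊆ closure (range a)) :
    ∀ᵐ x, x ∈ ⋂ n, (· + a n) ⁻¹' A → volume (ball x t \ A) = 0 := by
  have hI : MeasurableSet (⋂ n, (· + a n) ⁻¹' A) := .iInter fun n ↦ measurable_add_const _ hA
  have hm : MeasurableSet {p : ℝᵈ × ℝᵈ |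
      ¬ ((p.2 ∈ ⋂ n, (· + a n) ⁻¹' A) ∧ p.1 ∈ ball 0 t ∧ p.2 + p.1 ∉ A)} :=
    ((measurable_snd hI).inter ((measurable_fst measurableSet_ball).inter
      ((measurable_snd.add measurable_fst) hA.compl))).compl
  have hb : ∀ᵐ b : ℝᵈ, ∀ᵐ x,
      ¬ ((x ∈ ⋂ n, (· + a n) ⁻¹' A) ∧ b ∈ ball 0 t ∧ x + b ∉ A) := .of_forall fun b ↦ by
    by_cases hbt : b ∈ ball 0 t
    · filter_upwards [measure_eq_zero_iff_ae_notMem.1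
        (volume_iInter_preimage_add_right_diff hA.nullMeasurableSet hfin (ha hbt))]
        with x hx using fun h ↦ hx ⟨h.1, h.2.2⟩
    · exact .of_forall fun x h ↦ hbt h.2.1
  filter_upwards [(Measure.ae_ae_comm hm).1 hb] with x hx hxI
  rw [← measure_preimage_add volume x]
  refine measure_mono_null (fun b hb ↦ ?_) (measure_eq_zero_iff_ae_notMem.2 hx)
  exact ⟨hxI, by simpa using hb.1, hb.2⟩

theorem volume_compl_support_restrict_compl_diff (A : Set ℝᵈ) :
    volume ((volume.restrict Aᶜ).supportᶜ \ A) = 0 := by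
  have h := Measure.measure_compl_support (μ := (volume : Measure ℝᵈ).restrict Aᶜ)
  rwa [Measure.restrict_apply Measure.isOpen_compl_support.measurableSet] at h

theorem ae_mem_iInter_preimage_add_right {t : ℝ} {ι : Type*} [Countable ι] {a : ι → ℝᵈ}
    (ha : ∀ n, a n ∈ ball 0 t) :
    ∀ᵐ x, volume (ball x t \ A) = 0 → x ∈ ⋂ n, (· + a n) ⁻¹' A := by
  have hn (n : ι) : ∀ᵐ x, x + a n ∉ (volume.restrict Aᶜ).supportᶜ \ A :=
    (measurePreserving_add_right volume (a n)).quasiMeasurePreserving.ae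
      (measure_eq_zero_iff_ae_notMem.1 (volume_compl_support_restrict_compl_diff A))
  filter_upwards [ae_all_iff.2 hn] with x hx hball
  refine mem_iInter.2 fun n ↦ by_contra fun hxn ↦ hx n ⟨?_, hxn⟩
  refine Measure.subset_compl_support_of_isOpen isOpen_ball (t := ball x t) ?_
    (by simpa using ha n)
  rwa [Measure.restrict_apply measurableSet_ball]

theorem DecreasesPerimeter.setOf_le_infDist_support (h : DecreasesPerimeter A)
    (hA : MeasurableSet A) (hfin : volume A ≠ ⊤) (hne : (volume.restrict Aᶜ).support.Nonempty)
    {t : ℝ} (ht : 0 < t) :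
    DecreasesPerimeter {x | t ≤ infDist x (volume.restrict Aᶜ).support} := by
  have : Nonempty (ball (0 : ℝᵈ) t) := ⟨⟨0, mem_ball_self ht⟩⟩
  set a : ℕ → ℝᵈ := fun n ↦ (TopologicalSpace.denseSeq (ball (0 : ℝᵈ) t) n : ℝᵈ)
  have hat (n : ℕ) : a n ∈ ball 0 t := (TopologicalSpace.denseSeq (ball (0 : ℝᵈ) t) n).2
  have ha : ball 0 t ⊆ closure (range a) := by
    rw [show range a = Subtype.val '' range (TopologicalSpace.denseSeq (ball (0 : ℝᵈ) t)) from
      range_comp _ _]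
    exact Subtype.dense_iff.1 (TopologicalSpace.denseRange_denseSeq _)
  refine (DecreasesPerimeter.iInter (fun n ↦ h.preimage_add_right (a n))
    fun n ↦ measurable_add_const _ hA).congr (eventuallyEq_set.2 ?_)
  filter_upwards [ae_volume_ball_diff_eq_zero hA hfin ha,
    ae_mem_iInter_preimage_add_right (A := A) hat] with x hx hx'
  refine Iff.trans ⟨hx, hx'⟩ ?_
  rw [le_infDist_support_iff hne, Measure.restrict_apply measurableSet_ball]
  rfl

end InnerParallel

/-! ### Coarea inequality and least total variation -/

section Coarea

/-- The piecewise linear function of `s` which climbs from `0` at `t - 1 / (n + 1)` to `1` at `t`;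
it approximates the indicator function of `[t, ∞)`. -/
def levelRamp (n : ℕ) (t s : ℝ) : ℝ :=
  min (max ((n + 1) * (s - t) + 1) 0) 1

theorem norm_levelRamp_le_one (n : ℕ) (t s : ℝ) : ‖levelRamp n t s‖ ≤ 1 := by
  rw [levelRamp, Real.norm_of_nonneg (le_min (le_max_right _ _) zero_le_one)]
  exact min_le_right _ _

theorem tendsto_levelRamp (t s : ℝ) :
    Tendsto (fun n ↦ levelRamp n t s) atTop (𝓝 ((Ici t).indicator (fun _ ↦ 1) s)) := by
  rcases le_or_gt t s with hts | hst
  · refine tendsto_const_nhds.congr fun n ↦ ?_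
    have h1 : (1 : ℝ) ≤ (n + 1) * (s - t) + 1 :=
      le_add_of_nonneg_left (mul_nonneg (by positivity) (sub_nonneg.2 hts))
    rw [indicator_of_mem (mem_Ici.2 hts), levelRamp, min_eq_right (h1.trans (le_max_left _ _))]
  · refine tendsto_const_nhds.congr' ?_
    filter_upwards [(tendsto_one_div_add_atTop_nhds_zero_nat (𝕜 := ℝ)).eventually
      (gt_mem_nhds (sub_pos.2 hst))] with n hn
    rw [div_lt_iff₀ (by positivity)] at hn
    rw [indicator_of_notMem (notMem_Ici.2 hst), levelRamp, max_eq_right (by linarith),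
      min_eq_left zero_le_one]

/-- The total variation of a function `u` with gradient `g` over the layer of the levels in
`(t - 1 / (n + 1), t)`, divided by the thickness of the layer. Its lower limit as
`n → ∞` bounds the perimeter of `{u ≥ t}`. -/
def layerEnergy (u : ℝᵈ → ℝ) (g : ℝᵈ → ℝᵈ) (n : ℕ) (t : ℝ) : ℝ≥0∞ :=
  ENNReal.ofReal (n + 1) * ∫⁻ x in {x | u x ∈ Ioo (t - 1 / (n + 1)) t}, ‖g x‖ₑ

variable {u : EuclideanSpace ℝ (Fin d) → ℝ}
  {g : EuclideanSpace ℝ (Fin d) → EuclideanSpace ℝ (Fin d)}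

theorem MemSobolevLoc.levelRamp_comp (hu : MemSobolevLoc u g) (n : ℕ) (t : ℝ) :
    MemSobolevLoc (fun x ↦ levelRamp n t (u x))
      (indicator {x | u x ∈ Ioo (t - 1 / (n + 1)) t} fun x ↦ ((n : ℝ) + 1) • g x) := by
  have hone := memSobolevLoc_of_contDiff (d := d) (contDiff_const (c := (1 : ℝ)))
  refine ((((hu.add_const (-t)).const_mul (n + 1)).add_const 1).max_zero.min hone).congr .rfl
    (.of_forall fun x ↦ ?_)
  have hn : (0 : ℝ) < n + 1 := by positivity
  have hpos : 0 < (n + 1) * (u x + -t) + 1 ↔ t - 1 / (n + 1) < u x := by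
    rw [sub_lt_iff_lt_add', div_add' _ _ _ hn.ne', lt_div_iff₀ hn]
    constructor <;> intro h <;> linarith
  have hlt : max ((n + 1) * (u x + -t) + 1) 0 < 1 ↔ u x < t := by
    rw [max_lt_iff, and_iff_left zero_lt_one, add_lt_iff_neg_right, ← smul_eq_mul,
      smul_neg_iff_of_pos_left hn, ← sub_eq_add_neg, sub_neg]
  by_cases h1 : u x < t <;> simp [indicator, hpos, hlt, h1, gradient_fun_const]

theorem perimeter_setOf_le_le_liminf_layerEnergy (hu : MemSobolevLoc u g) (hum : Measurable u)
    (t : ℝ) : perimeter {x | t ≤ u x} ≤ liminf (fun n ↦ layerEnergy u g n t) atTop := by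
  refine (perimeter_le_liminf_lintegral_enorm (measurableSet_le measurable_const hum)
    (fun n ↦ hu.levelRamp_comp n t) (fun n x ↦ norm_levelRamp_le_one n t (u x))
    (.of_forall fun x ↦ tendsto_levelRamp t (u x))).trans_eq ?_
  congr with n
  simp only [enorm_indicator_eq_indicator_enorm, enorm_smul]
  have hmeas : MeasurableSet {x | u x ∈ Ioo (t - 1 / ((n : ℝ) + 1)) t} := hum measurableSet_Ioo
  rw [lintegral_indicator hmeas, lintegral_const_mul'' _
    hu.locallyIntegrable_grad.aestronglyMeasurable.enorm.restrict, layerEnergy,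
    Real.enorm_of_nonneg (by positivity)]

theorem aemeasurable_indicator_Ioo {α : Type*} [MeasurableSpace α] {μ : Measure α}
    {u : α → ℝ} (hu : Measurable u) {f : α → ℝ≥0∞} (hf : AEMeasurable f μ) (ε : ℝ) :
    AEMeasurable (fun p : ℝ × α ↦ indicator {x | u x ∈ Ioo (p.1 - ε) p.1} f p.2)
      (volume.prod μ) := by
  have hm : MeasurableSet {p : ℝ × α | u p.2 ∈ Ioo (p.1 - ε) p.1} :=
    (measurableSet_lt (measurable_fst.sub_const _) (hu.comp measurable_snd)).inter
      (measurableSet_lt (hu.comp measurable_snd) measurable_fst)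
  exact hf.comp_snd.indicator hm

theorem lintegral_setLIntegral_Ioo {α : Type*} [MeasurableSpace α] {μ : Measure α} [SFinite μ]
    {u : α → ℝ} (hu : Measurable u) {f : α → ℝ≥0∞} (hf : AEMeasurable f μ) (ε : ℝ) :
    ∫⁻ t, ∫⁻ x in {x | u x ∈ Ioo (t - ε) t}, f x ∂μ = ENNReal.ofReal ε * ∫⁻ x, f x ∂μ := by
  have hswap := lintegral_lintegral_swap
    (f := fun t x ↦ indicator {x | u x ∈ Ioo (t - ε) t} f x) (aemeasurable_indicator_Ioo hu hf ε)
  have hlayer (x : α) (t : ℝ) : indicator {x | u x ∈ Ioo (t - ε) t} f x =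
      indicator (Ioo (u x) (u x + ε)) (fun _ ↦ f x) t := by
    simp only [indicator, mem_ofPred_eq, mem_Ioo, sub_lt_iff_lt_add, and_comm]
  calc ∫⁻ t, ∫⁻ x in {x | u x ∈ Ioo (t - ε) t}, f x ∂μ
      = ∫⁻ t, ∫⁻ x, indicator {x | u x ∈ Ioo (t - ε) t} f x ∂μ :=
        lintegral_congr fun t ↦ (lintegral_indicator (hu measurableSet_Ioo) f).symm
    _ = ∫⁻ x, ∫⁻ t, indicator (Ioo (u x) (u x + ε)) (fun _ ↦ f x) t ∂volume ∂μ :=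
        hswap.trans (lintegral_congr fun x ↦ lintegral_congr fun t ↦ hlayer x t)
    _ = ∫⁻ x, ENNReal.ofReal ε * f x ∂μ := lintegral_congr fun x ↦ by
        rw [lintegral_indicator measurableSet_Ioo, setLIntegral_const, Real.volume_Ioo,
          add_sub_cancel_left, mul_comm]
    _ = ENNReal.ofReal ε * ∫⁻ x, f x ∂μ := lintegral_const_mul'' _ hf

theorem lintegral_layerEnergy (hum : Measurable u) (hg : AEStronglyMeasurable g volume) (n : ℕ) :
    ∫⁻ t, layerEnergy u g n t = ∫⁻ x, ‖g x‖ₑ := by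
  have hn : (0 : ℝ) < n + 1 := by positivity
  simp only [layerEnergy]
  rw [lintegral_const_mul' _ _ ENNReal.ofReal_ne_top, lintegral_setLIntegral_Ioo hum hg.enorm,
    ← mul_assoc, ← ENNReal.ofReal_mul hn.le, mul_one_div_cancel hn.ne', ENNReal.ofReal_one, one_mul]

theorem aemeasurable_layerEnergy (hum : Measurable u) (hg : AEStronglyMeasurable g volume)
    (n : ℕ) : AEMeasurable (layerEnergy u g n) := by
  refine AEMeasurable.const_mul ?_ _
  refine (aemeasurable_indicator_Ioo hum hg.enorm (1 / (n + 1))).lintegral_prod_right'.congr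
    (.of_forall fun t ↦ ?_)
  have hmeas : MeasurableSet {x | u x ∈ Ioo (t - 1 / ((n : ℝ) + 1)) t} := hum measurableSet_Ioo
  exact lintegral_indicator hmeas _

theorem lintegral_perimeter_setOf_le_le (hu : MemSobolevLoc u g) (hum : Measurable u) :
    ∫⁻ t, perimeter {x | t ≤ u x} ≤ ∫⁻ x, ‖g x‖ₑ := by
  have hg := hu.locallyIntegrable_grad.aestronglyMeasurable
  calc ∫⁻ t, perimeter {x | t ≤ u x} ≤ ∫⁻ t, liminf (fun n ↦ layerEnergy u g n t) atTop :=
        lintegral_mono fun t ↦ perimeter_setOf_le_le_liminf_layerEnergy hu hum t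
    _ ≤ liminf (fun n ↦ ∫⁻ t, layerEnergy u g n t) atTop :=
        lintegral_liminf_le' fun n ↦ aemeasurable_layerEnergy hum hg n
    _ = ∫⁻ x, ‖g x‖ₑ := by simp only [lintegral_layerEnergy hum hg, liminf_const]

section LayerCake

variable {α : Type*} [MeasurableSpace α] {μ : Measure α} {δ f : α → ℝ}

theorem integrable_indicator_setOf_le (hδ : Measurable δ) (hf : Integrable f μ) (R : ℝ) :
    Integrable (Function.uncurry fun (x : α) (t : ℝ) ↦ indicator {x | t ≤ δ x} f x)
      (μ.prod (volume.restrict (Ioc 0 R))) := by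
  have hS : MeasurableSet {p : α × ℝ | p.2 ≤ δ p.1} :=
    measurableSet_le measurable_snd (hδ.comp measurable_fst)
  have hfst : Integrable (fun p : α × ℝ ↦ f p.1) (μ.prod (volume.restrict (Ioc 0 R))) :=
    hf.comp_fst _
  exact hfst.indicator hS

theorem integrableOn_setIntegral_setOf_le [SFinite μ] (hδ : Measurable δ) (hf : Integrable f μ)
    (R : ℝ) :
    IntegrableOn (fun t ↦ ∫ x in {x | t ≤ δ x}, f x ∂μ) (Ioc 0 R) :=
  (integrable_indicator_setOf_le hδ hf R).integral_prod_right.congr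
    (.of_forall fun _ ↦ integral_indicator (measurableSet_le measurable_const hδ))

theorem integral_mul_eq_integral_setIntegral_setOf_le [SFinite μ] (hδ : Measurable δ)
    (hδ0 : ∀ x, 0 ≤ δ x) {R : ℝ} (hδR : ∀ x, δ x ≤ R) (hf : Integrable f μ) :
    ∫ x, δ x * f x ∂μ = ∫ t in Ioc 0 R, ∫ x in {x | t ≤ δ x}, f x ∂μ := by
  have hlayer (x : α) : ∫ t in Ioc 0 R, indicator {x | t ≤ δ x} f x = δ x * f x := by
    have hIic (t : ℝ) : indicator {x | t ≤ δ x} f x = indicator (Iic (δ x)) (fun _ ↦ f x) t := rfl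
    simp only [hIic]
    rw [setIntegral_indicator measurableSet_Iic, Ioc_inter_Iic, min_eq_right (hδR x),
      setIntegral_const, smul_eq_mul, Real.volume_real_Ioc_of_le (hδ0 x), sub_zero]
  calc ∫ x, δ x * f x ∂μ = ∫ x, ∫ t in Ioc 0 R, indicator {x | t ≤ δ x} f x ∂volume ∂μ := by
        simp only [hlayer]
    _ = ∫ t in Ioc 0 R, ∫ x, indicator {x | t ≤ δ x} f x ∂μ :=
        integral_integral_swap (integrable_indicator_setOf_le hδ hf R)
    _ = ∫ t in Ioc 0 R, ∫ x in {x | t ≤ δ x}, f x ∂μ :=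
        integral_congr_ae (.of_forall fun _ ↦
          integral_indicator (measurableSet_le measurable_const hδ))

end LayerCake

theorem ofReal_integral_le_lintegral_ofReal {α : Type*} [MeasurableSpace α] {μ : Measure α}
    {f : α → ℝ} (hf : Integrable f μ) :
    ENNReal.ofReal (∫ x, f x ∂μ) ≤ ∫⁻ x, ENNReal.ofReal (f x) ∂μ := by
  calc ENNReal.ofReal (∫ x, f x ∂μ) ≤ ENNReal.ofReal (∫ x, max (f x) 0 ∂μ) :=
        ENNReal.ofReal_le_ofReal (integral_mono hf hf.pos_part fun x ↦ le_max_left _ _)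
    _ = ∫⁻ x, ENNReal.ofReal (f x) ∂μ := by
        rw [ofReal_integral_eq_lintegral_ofReal hf.pos_part (.of_forall fun x ↦ le_max_right _ _)]
        simp

theorem IsTestField.ofReal_integral_mul_divergence_le_lintegral_perimeter {T : ℝᵈ → ℝᵈ}
    (hT : IsTestField T) {δ : ℝᵈ → ℝ} (hδ : Measurable δ) (hδ0 : ∀ x, 0 ≤ δ x) {R : ℝ}
    (hδR : ∀ x, δ x ≤ R) :
    ENNReal.ofReal (∫ x, δ x * divergence T x) ≤ ∫⁻ t in Ioi 0, perimeter {x | t ≤ δ x} := by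
  rw [integral_mul_eq_integral_setIntegral_setOf_le hδ hδ0 hδR hT.integrable_divergence]
  calc ENNReal.ofReal (∫ t in Ioc 0 R, ∫ x in {x | t ≤ δ x}, divergence T x)
      ≤ ∫⁻ t in Ioc 0 R, ENNReal.ofReal (∫ x in {x | t ≤ δ x}, divergence T x) :=
        ofReal_integral_le_lintegral_ofReal
          (integrableOn_setIntegral_setOf_le hδ hT.integrable_divergence R)
    _ ≤ ∫⁻ t in Ioc 0 R, perimeter {x | t ≤ δ x} :=
        lintegral_mono fun t ↦ hT.ofReal_setIntegral_divergence_le _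
    _ ≤ ∫⁻ t in Ioi 0, perimeter {x | t ≤ δ x} :=
        lintegral_mono_set Ioc_subset_Ioi_self

theorem lintegral_enorm_le_of_decreasesPerimeter {δ : ℝᵈ → ℝ} {g₀ : ℝᵈ → ℝᵈ}
    (hδ : MemSobolevLoc δ g₀) (hδm : Measurable δ) (hδ0 : ∀ x, 0 ≤ δ x) {R : ℝ}
    (hδR : ∀ x, δ x ≤ R) (hdec : ∀ t > 0, DecreasesPerimeter {x | t ≤ δ x})
    (hu : MemSobolevLoc u g) (hum : Measurable u) (hle : ∀ x, δ x ≤ u x)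
    (hfin : ∀ t > 0, volume {x | t ≤ u x} ≠ ⊤) : ∫⁻ x, ‖g₀ x‖ₑ ≤ ∫⁻ x, ‖g x‖ₑ := by
  refine lintegral_enorm_le_of_forall_integral_inner_le hδ.locallyIntegrable_grad fun T hT ↦ ?_
  have hpair := hδ.integral_mul_divergence hT.neg.contDiff hT.neg.hasCompactSupport
  simp only [inner_neg_right, integral_neg, neg_neg] at hpair
  have hlevel : ∀ t ∈ Ioi (0 : ℝ), perimeter {x | t ≤ δ x} ≤ perimeter {x | t ≤ u x} := by
    intro t ht
    have hsub : {x | t ≤ u x} ∩ {x | t ≤ δ x} = {x | t ≤ δ x} :=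
      inter_eq_right.2 fun x hx ↦ le_trans hx (hle x)
    exact hsub ▸ hdec t ht {x | t ≤ u x} (measurableSet_le measurable_const hum) (hfin t ht)
  calc ENNReal.ofReal (∫ x, inner ℝ (g₀ x) (T x))
      ≤ ∫⁻ t in Ioi 0, perimeter {x | t ≤ δ x} := by
        rw [← hpair]
        exact hT.neg.ofReal_integral_mul_divergence_le_lintegral_perimeter hδm hδ0 hδR
    _ ≤ ∫⁻ t in Ioi 0, perimeter {x | t ≤ u x} := setLIntegral_mono' measurableSet_Ioi hlevel
    _ ≤ ∫⁻ t, perimeter {x | t ≤ u x} := setLIntegral_le_lintegral _ _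
    _ ≤ ∫⁻ x, ‖g x‖ₑ := lintegral_perimeter_setOf_le_le hu hum

end Coarea

/-! ### Sobolev functions vanishing outside of a set -/

section SobolevLike

theorem memLp_of_memLp_of_ae_eq_zero {α F : Type*} [MeasurableSpace α] [NormedAddCommGroup F]
    {μ : Measure α} {p q : ℝ≥0∞} {f : α → F} {s : Set α} (hf : MemLp f q μ) (hs : μ s ≠ ⊤)
    (h0 : ∀ᵐ x ∂μ, x ∉ s → f x = 0) (hpq : p ≤ q) : MemLp f p μ := by
  have hfs : f =ᵐ[μ] s.indicator f := by
    filter_upwards [h0] with x hx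
    by_cases hxs : x ∈ s
    · rw [indicator_of_mem hxs]
    · rw [indicator_of_notMem hxs, hx hxs]
  exact ((hf.ae_eq hfs).mono_exponent_of_measure_support_ne_top
    (fun x hx ↦ indicator_of_notMem hx f) hs hpq).ae_eq hfs.symm

theorem integrable_inner_of_memLp_two {α F : Type*} [MeasurableSpace α] [NormedAddCommGroup F]
    [InnerProductSpace ℝ F] {μ : Measure α} {f g : α → F} (hf : MemLp f 2 μ) (hg : MemLp g 2 μ) :
    Integrable (fun x ↦ inner ℝ (f x) (g x)) μ :=
  (hf.norm.integrable_mul hg.norm).mono' (hf.1.inner hg.1)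
    (.of_forall fun _ ↦ norm_inner_le_norm _ _)

variable {Ω Ω' : Set (EuclideanSpace ℝ (Fin d))} {u v : EuclideanSpace ℝ (Fin d) → ℝ}
  {g h : EuclideanSpace ℝ (Fin d) → EuclideanSpace ℝ (Fin d)}

theorem MemSobolevLoc.memSobolevLike_of_norm_le (hu : MemSobolevLoc u g) (hΩ : volume Ω ≠ ⊤)
    {M N : ℝ} (hM : ∀ x, ‖u x‖ ≤ M) (hN : ∀ x, ‖g x‖ ≤ N) (h0 : ∀ᵐ x, x ∉ Ω → u x = 0) :
    MemSobolevLike Ω u g where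
  memLp := memLp_of_memLp_of_ae_eq_zero (memLp_top_of_bound
    hu.locallyIntegrable.aestronglyMeasurable M (.of_forall hM)) hΩ h0 le_top
  memLp_grad := memLp_of_memLp_of_ae_eq_zero (memLp_top_of_bound
    hu.locallyIntegrable_grad.aestronglyMeasurable N (.of_forall hN)) hΩ
    (by filter_upwards [h0, hu.ae_eq_zero_of_eq_zero] with x h1 h2 hx using h2 (h1 hx)) le_top
  hasWeakGradient := hu.hasWeakGradient
  ae_eq_zero := h0

namespace MemSobolevLike

theorem grad_ae_eq_zero (hu : MemSobolevLike Ω u g) : ∀ᵐ x, x ∉ Ω → g x = 0 := by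
  filter_upwards [hu.ae_eq_zero, hu.memSobolevLoc.ae_eq_zero_of_eq_zero] with x h1 h2 hx
    using h2 (h1 hx)

theorem integrable (hu : MemSobolevLike Ω u g) (hΩ : volume Ω ≠ ⊤) : Integrable u :=
  memLp_one_iff_integrable.1
    (memLp_of_memLp_of_ae_eq_zero hu.memLp hΩ hu.ae_eq_zero one_le_two)

theorem integrable_grad (hu : MemSobolevLike Ω u g) (hΩ : volume Ω ≠ ⊤) : Integrable g :=
  memLp_one_iff_integrable.1
    (memLp_of_memLp_of_ae_eq_zero hu.memLp_grad hΩ hu.grad_ae_eq_zero one_le_two)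

theorem congr (hu : MemSobolevLike Ω u g) (huv : u =ᵐ[volume] v) : MemSobolevLike Ω v g where
  memLp := hu.memLp.ae_eq huv
  memLp_grad := hu.memLp_grad
  hasWeakGradient := (hu.memSobolevLoc.congr huv .rfl).hasWeakGradient
  ae_eq_zero := by
    filter_upwards [hu.ae_eq_zero, huv] with x h1 h2 hx
    rw [← h2, h1 hx]

theorem congr_set (hu : MemSobolevLike Ω u g) (hΩ : Ω =ᵐ[volume] Ω') : MemSobolevLike Ω' u g where
  __ := hu
  ae_eq_zero := by
    filter_upwards [hu.ae_eq_zero, eventuallyEq_set.1 hΩ] with x h1 h2 hx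
    exact h1 fun hxΩ ↦ hx (h2.1 hxΩ)

theorem mono (hu : MemSobolevLike Ω u g) (hΩ : Ω ⊆ Ω') : MemSobolevLike Ω' u g where
  __ := hu
  ae_eq_zero := hu.ae_eq_zero.mono fun _ h0 hx ↦ h0 fun hxΩ ↦ hx (hΩ hxΩ)

theorem const_mul (hu : MemSobolevLike Ω u g) (c : ℝ) :
    MemSobolevLike Ω (fun x ↦ c * u x) fun x ↦ c • g x where
  memLp := hu.memLp.const_mul c
  memLp_grad := hu.memLp_grad.const_smul c
  hasWeakGradient := (hu.memSobolevLoc.const_mul c).hasWeakGradient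
  ae_eq_zero := by
    filter_upwards [hu.ae_eq_zero] with x h1 hx
    rw [h1 hx, mul_zero]

theorem neg (hu : MemSobolevLike Ω u g) : MemSobolevLike Ω (fun x ↦ -u x) fun x ↦ -g x := by
  simpa using hu.const_mul (-1)

theorem sub (hu : MemSobolevLike Ω u g) (hv : MemSobolevLike Ω v h) :
    MemSobolevLike Ω (fun x ↦ u x - v x) fun x ↦ g x - h x where
  memLp := hu.memLp.sub hv.memLp
  memLp_grad := hu.memLp_grad.sub hv.memLp_grad
  hasWeakGradient := (hu.memSobolevLoc.sub hv.memSobolevLoc).hasWeakGradient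
  ae_eq_zero := by
    filter_upwards [hu.ae_eq_zero, hv.ae_eq_zero] with x h1 h2 hx
    rw [h1 hx, h2 hx, sub_zero]

theorem lipschitz_mul (hu : MemSobolevLike Ω u g) {C M : ℝ≥0} {a : ℝᵈ → ℝ}
    (ha : LipschitzWith C a) (hM : ∀ x, ‖a x‖ ≤ M) :
    MemSobolevLike Ω (fun x ↦ a x * u x) fun x ↦ a x • g x + u x • gradient a x := by
  have ha_top : MemLp a ⊤ volume :=
    memLp_top_of_bound ha.continuous.aestronglyMeasurable M (.of_forall hM)
  have hga_top : MemLp (gradient a) ⊤ volume :=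
    memLp_top_of_bound (measurable_gradient a).aestronglyMeasurable C
      (.of_forall (norm_gradient_le_of_lipschitzWith ha))
  refine ⟨hu.memLp.smul ha_top, (hu.memLp_grad.smul ha_top).add (hga_top.smul hu.memLp),
    (hu.memSobolevLoc.lipschitz_mul ha hM).hasWeakGradient, ?_⟩
  filter_upwards [hu.ae_eq_zero] with x h1 hx
  rw [h1 hx, mul_zero]

theorem comp_add (hu : MemSobolevLike Ω u g) (a : ℝᵈ) :
    MemSobolevLike ((· + a) ⁻¹' Ω) (fun x ↦ u (x + a)) fun x ↦ g (x + a) where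
  memLp := hu.memLp.comp_measurePreserving (measurePreserving_add_right volume a)
  memLp_grad := hu.memLp_grad.comp_measurePreserving (measurePreserving_add_right volume a)
  hasWeakGradient := (hu.memSobolevLoc.comp_add a).hasWeakGradient
  ae_eq_zero := (measurePreserving_add_right volume a).quasiMeasurePreserving.ae hu.ae_eq_zero

end MemSobolevLike

theorem MemSobolevLoc.memSobolevLike_max_zero (hu : MemSobolevLoc u g) {f : ℝᵈ → ℝ}
    (hf : MemLp f 2) (huf : ∀ᵐ x, u x ≤ ‖f x‖) (hg : MemLp g 2) (h0 : ∀ᵐ x, x ∉ Ω → u x ≤ 0) :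
    MemSobolevLike Ω (fun x ↦ max (u x) 0) (indicator {x | 0 < u x} g) where
  memLp := hf.mono hu.max_zero.locallyIntegrable.aestronglyMeasurable <| by
    filter_upwards [huf] with x hx
    rw [Real.norm_of_nonneg (le_max_right _ _)]
    exact max_le hx (norm_nonneg _)
  memLp_grad := hg.mono hu.max_zero.locallyIntegrable_grad.aestronglyMeasurable
    (.of_forall fun _ ↦ norm_indicator_le_norm_self _ _)
  hasWeakGradient := hu.max_zero.hasWeakGradient
  ae_eq_zero := by
    filter_upwards [h0] with x h1 hx using max_eq_right (h1 hx)

namespace MemSobolevLike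

theorem max_zero (hu : MemSobolevLike Ω u g) :
    MemSobolevLike Ω (fun x ↦ max (u x) 0) (indicator {x | 0 < u x} g) :=
  hu.memSobolevLoc.memSobolevLike_max_zero hu.memLp (.of_forall fun _ ↦ le_abs_self _)
    hu.memLp_grad (by filter_upwards [hu.ae_eq_zero] with x h1 hx using (h1 hx).le)

theorem ae_eq_zero_of_grad_ae_eq_zero (hu : MemSobolevLike Ω u g) (hΩ : volume Ωᶜ ≠ 0)
    (hg : g =ᵐ[volume] fun _ ↦ 0) : ∀ᵐ x, u x = 0 := by
  obtain ⟨c, hc⟩ := (hu.memSobolevLoc.congr .rfl hg).exists_ae_eq_const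
  obtain ⟨x, hxΩ, hxc, hx0⟩ := ((frequently_ae_mem_iff.2 hΩ).and_eventually
    (hc.and hu.ae_eq_zero)).exists
  filter_upwards [hc] with y hy
  rw [hy, ← hxc, hx0 hxΩ]

end MemSobolevLike

theorem inner_indicator_self_right {α F : Type*} [NormedAddCommGroup F] [InnerProductSpace ℝ F]
    (s : Set α) (f : α → F) (x : α) :
    inner ℝ (f x) (s.indicator f x) = ‖s.indicator f x‖ ^ 2 := by
  by_cases hx : x ∈ s <;> simp [hx]

theorem ae_nonpos_of_integral_inner_indicator_nonpos (hΩ : volume Ωᶜ ≠ 0)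
    (hu : MemSobolevLike Ω (fun x ↦ max (u x) 0) (indicator {x | 0 < u x} g))
    (hle : ∫ x, inner ℝ (g x) (indicator {x | 0 < u x} g x) ≤ 0) : ∀ᵐ x, u x ≤ 0 := by
  simp only [inner_indicator_self_right] at hle
  have hsq := (memLp_two_iff_integrable_sq_norm hu.memLp_grad.1).1 hu.memLp_grad
  have hzero := (integral_eq_zero_iff_of_nonneg (fun _ ↦ sq_nonneg _) hsq).1
    (hle.antisymm (integral_nonneg fun _ ↦ sq_nonneg _))
  filter_upwards [hu.ae_eq_zero_of_grad_ae_eq_zero hΩ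
    (hzero.mono fun x hx ↦ by simpa using hx)] with x hx
  exact max_eq_right_iff.1 hx

end SobolevLike

/-! ### The distance to a closed set -/

section InfDist

theorem infDist_lineMap {E : Type*} [SeminormedAddCommGroup E] [NormedSpace ℝ E] {C : Set E}
    {x z : E} (hz : z ∈ C) (hxz : infDist x C = dist x z) {s : ℝ} (hs : s ∈ Icc (0 : ℝ) 1) :
    infDist (AffineMap.lineMap x z s) C = (1 - s) * dist x z := by
  refine le_antisymm ?_ ?_
  · refine (infDist_le_dist_of_mem hz).trans_eq ?_
    rw [dist_lineMap_right, Real.norm_of_nonneg (sub_nonneg.2 hs.2)]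
  · have h := infDist_le_infDist_add_dist (s := C) (x := x) (y := AffineMap.lineMap x z s)
    rw [hxz, dist_left_lineMap, Real.norm_of_nonneg hs.1] at h
    linarith

theorem fderiv_infDist_sub {E : Type*} [NormedAddCommGroup E] [NormedSpace ℝ E] {C : Set E}
    {x z : E} (hz : z ∈ C) (hxz : infDist x C = dist x z)
    (hd : DifferentiableAt ℝ (infDist · C) x) : fderiv ℝ (infDist · C) x (z - x) = -dist x z := by
  have hseg : HasDerivWithinAt (fun s : ℝ ↦ infDist (AffineMap.lineMap x z s) C)
      (fderiv ℝ (infDist · C) x (z - x)) (Icc 0 1) 0 := by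
    have hline : HasDerivAt (AffineMap.lineMap x z : ℝ → E) (z - x) 0 :=
      AffineMap.hasDerivAt_lineMap
    exact (hd.hasFDerivAt.comp_hasDerivAt_of_eq 0 hline (by simp)).hasDerivWithinAt
  have hlin : HasDerivWithinAt (fun s : ℝ ↦ infDist (AffineMap.lineMap x z s) C)
      (-dist x z) (Icc 0 1) 0 := by
    have h : HasDerivAt (fun s : ℝ ↦ (1 - s) * dist x z) (-dist x z) 0 := by
      simpa using ((hasDerivAt_id (0 : ℝ)).const_sub 1).mul_const (dist x z)
    exact h.hasDerivWithinAt.congr (fun s hs ↦ infDist_lineMap hz hxz hs)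
      (infDist_lineMap hz hxz (left_mem_Icc.2 zero_le_one))
  exact (uniqueDiffOn_Icc zero_lt_one 0 (left_mem_Icc.2 zero_le_one)).eq_deriv _ hseg hlin

section Gradient

variable {E : Type*} [NormedAddCommGroup E] [InnerProductSpace ℝ E] [FiniteDimensional ℝ E]
  {C : Set E}

theorem norm_gradient_infDist_le (x : E) : ‖gradient (infDist · C) x‖ ≤ 1 := by
  simpa using norm_gradient_le_of_lipschitzWith (lipschitz_infDist_pt C) x

theorem norm_gradient_infDist (hC : IsClosed C) (hne : C.Nonempty) {x : E} (hx : x ∉ C)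
    (hd : DifferentiableAt ℝ (infDist · C) x) : ‖gradient (infDist · C) x‖ = 1 := by
  obtain ⟨z, hz, hxz⟩ := hC.exists_infDist_eq_dist hne x
  have hpos : 0 < dist x z := dist_pos.2 fun h ↦ hx (h ▸ hz)
  refine le_antisymm (norm_gradient_infDist_le x) (le_of_mul_le_mul_right ?_ hpos)
  calc 1 * dist x z = |inner ℝ (gradient (infDist · C) x) (z - x)| := by
        rw [inner_gradient_left, fderiv_infDist_sub hz hxz hd, abs_neg, abs_of_pos hpos, one_mul]
    _ ≤ ‖gradient (infDist · C) x‖ * dist x z := by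
        rw [dist_eq_norm']
        exact abs_real_inner_le_norm _ _

theorem ae_norm_gradient_infDist [MeasurableSpace E] [BorelSpace E] (hC : IsClosed C)
    (hne : C.Nonempty) : ∀ᵐ x, x ∉ C → ‖gradient (infDist · C) x‖ = 1 := by
  filter_upwards [(lipschitz_infDist_pt C).ae_differentiableAt (μ := volume)] with x hd hx
  exact norm_gradient_infDist hC hne hx hd

end Gradient

section Measure

variable {E : Type*} [NormedAddCommGroup E] [NormedSpace ℝ E] [FiniteDimensional ℝ E]
  [Nontrivial E] [MeasurableSpace E] [BorelSpace E] {μ : Measure E} [μ.IsAddHaarMeasure]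
  {C : Set E}

theorem measure_ne_zero_of_measure_compl_ne_top (hfin : μ Cᶜ ≠ ⊤) : μ C ≠ 0 := by
  have : NoncompactSpace E := NormedSpace.noncompactSpace ℝ E
  intro h0
  rw [measure_congr (eventuallyEq_univ.2 (compl_mem_ae_iff.2 h0)),
    measure_univ_of_isAddLeftInvariant] at hfin
  exact hfin rfl

theorem exists_forall_infDist_le (hfin : μ Cᶜ ≠ ⊤) : ∃ R, ∀ x, infDist x C ≤ R := by
  have : NoncompactSpace E := NormedSpace.noncompactSpace ℝ E
  have hlim : Tendsto (fun n : ℕ ↦ μ (ball 0 n)) atTop (𝓝 ⊤) := by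
    have h := tendsto_measure_iUnion_atTop (μ := μ) (s := fun n : ℕ ↦ ball (0 : E) n)
      fun m n hmn ↦ ball_subset_ball (by exact_mod_cast hmn)
    rwa [iUnion_ball_nat, measure_univ_of_isAddLeftInvariant] at h
  obtain ⟨n, hn⟩ := (hlim.eventually (lt_mem_nhds hfin.lt_top)).exists
  refine ⟨n, fun x ↦ not_lt.1 fun hx ↦ hn.not_ge ?_⟩
  rw [← Measure.addHaar_ball_center μ x]
  refine measure_mono fun y hy hyC ↦ ?_
  exact (hx.trans_le (infDist_le_dist_of_mem hyC)).not_gt (mem_ball'.1 hy)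

end Measure

end InfDist

/-! ### Superharmonicity of the distance -/

section Superharmonic

/-- The weak formulation of `-div G ≥ c` in `Ω`, the test functions being the nonnegative elements
of `{v ∈ H¹(ℝ^d) : v = 0 a.e. on Ωᶜ}`. -/
def IsWeakSupersolution (Ω : Set ℝᵈ) (c : ℝ) (G : ℝᵈ → ℝᵈ) : Prop :=
  ∀ (v : ℝᵈ → ℝ) (h : ℝᵈ → ℝᵈ), MemSobolevLike Ω v h → (∀ᵐ x, 0 ≤ v x) →
    c * ∫ x, v x ≤ ∫ x, inner ℝ (G x) (h x)

variable {C : Set (EuclideanSpace ℝ (Fin d))} {R : ℝ}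

theorem memSobolevLike_infDist (hfin : volume Cᶜ ≠ ⊤) (hR : ∀ x : ℝᵈ, infDist x C ≤ R) :
    MemSobolevLike Cᶜ (infDist · C) (gradient (infDist · C)) :=
  (memSobolevLoc_of_lipschitzWith (lipschitz_infDist_pt C)).memSobolevLike_of_norm_le hfin
    (fun x ↦ (Real.norm_of_nonneg infDist_nonneg).trans_le (hR x)) norm_gradient_infDist_le
    (.of_forall fun _ hx ↦ infDist_zero_of_mem (not_not.1 hx))

theorem lintegral_enorm_gradient_infDist_le (hfin : volume Cᶜ ≠ ⊤)
    (hR : ∀ x : ℝᵈ, infDist x C ≤ R) (hdec : ∀ t > 0, DecreasesPerimeter {x | t ≤ infDist x C})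
    {v : ℝᵈ → ℝ} {h : ℝᵈ → ℝᵈ} (hv : MemSobolevLike Cᶜ v h) (hv0 : ∀ᵐ x, 0 ≤ v x) :
    ∫⁻ x, ‖gradient (infDist · C) x‖ₑ ≤ ∫⁻ x, ‖gradient (infDist · C) x + h x‖ₑ := by
  obtain ⟨v', hv'm, hv'0, hvv'⟩ : ∃ v' : ℝᵈ → ℝ, Measurable v' ∧ (∀ x, 0 ≤ v' x) ∧
      v =ᵐ[volume] v' := by
    refine ⟨fun x ↦ max (hv.memLp.1.mk v x) 0,
      hv.memLp.1.stronglyMeasurable_mk.measurable.max measurable_const,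
      fun x ↦ le_max_right _ _, ?_⟩
    filter_upwards [hv0, hv.memLp.1.ae_eq_mk] with x h1 h2
    rw [← h2, max_eq_left h1]
  have hv' := hv.congr hvv'
  have hδ := memSobolevLoc_of_lipschitzWith (lipschitz_infDist_pt C)
  have hδm : Measurable (infDist · C) := (continuous_infDist_pt C).measurable
  refine lintegral_enorm_le_of_decreasesPerimeter hδ hδm (fun _ ↦ infDist_nonneg) hR hdec
    (hδ.add hv'.memSobolevLoc) (hδm.add hv'm) (fun x ↦ le_add_of_nonneg_right (hv'0 x))
    fun t ht ↦ ne_top_of_le_ne_top hfin (measure_mono_ae ?_)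
  filter_upwards [hv'.ae_eq_zero] with x hx hxt
  by_contra hxC
  have hsum : t ≤ infDist x C + v' x := hxt
  rw [infDist_zero_of_mem (not_not.1 hxC), hx hxC, add_zero] at hsum
  exact ht.not_ge hsum

theorem norm_add_le_of_norm_eq_one {F : Type*} [NormedAddCommGroup F] [InnerProductSpace ℝ F]
    {x : F} (hx : ‖x‖ = 1) (y : F) : ‖x + y‖ ≤ 1 + inner ℝ x y + ‖y‖ ^ 2 / 2 := by
  have hsq := norm_add_sq_real x y
  rw [hx] at hsq
  nlinarith [sq_nonneg (‖x + y‖ - 1)]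

theorem integral_inner_add_integral_norm_sq_nonneg (hC : IsClosed C) (hne : C.Nonempty)
    (hfin : volume Cᶜ ≠ ⊤) (hR : ∀ x : ℝᵈ, infDist x C ≤ R)
    (hdec : ∀ t > 0, DecreasesPerimeter {x | t ≤ infDist x C}) {v : ℝᵈ → ℝ} {h : ℝᵈ → ℝᵈ}
    (hv : MemSobolevLike Cᶜ v h) (hv0 : ∀ᵐ x, 0 ≤ v x) :
    0 ≤ (∫ x, inner ℝ (gradient (infDist · C) x) (h x)) + ∫ x, ‖h x‖ ^ 2 / 2 := by
  have hδ := memSobolevLike_infDist hfin hR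
  have hG : Integrable (gradient (infDist · C)) := hδ.integrable_grad hfin
  have hGh : Integrable fun x ↦ gradient (infDist · C) x + h x := hG.add (hv.integrable_grad hfin)
  have hin := integrable_inner_of_memLp_two hδ.memLp_grad hv.memLp_grad
  have hsq := ((memLp_two_iff_integrable_sq_norm hv.memLp_grad.1).1 hv.memLp_grad).div_const 2
  have hmin : ∫ x, ‖gradient (infDist · C) x‖ ≤ ∫ x, ‖gradient (infDist · C) x + h x‖ := by
    refine (ENNReal.ofReal_le_ofReal_iff (integral_nonneg fun _ ↦ norm_nonneg _)).1 ?_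
    rw [ofReal_integral_norm_eq_lintegral_enorm hG, ofReal_integral_norm_eq_lintegral_enorm hGh]
    exact lintegral_enorm_gradient_infDist_le hfin hR hdec hv hv0
  rw [← integral_add hin hsq]
  refine (sub_nonneg.2 hmin).trans ?_
  rw [← integral_sub hGh.norm hG.norm]
  refine integral_mono_ae (hGh.norm.sub hG.norm) (hin.add hsq) ?_
  filter_upwards [hδ.grad_ae_eq_zero, hv.grad_ae_eq_zero, ae_norm_gradient_infDist hC hne]
    with x hδ0 hh0 hδ1
  by_cases hx : x ∈ C
  · simp [hδ0 (not_not.2 hx), hh0 (not_not.2 hx)]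
  · have hle := norm_add_le_of_norm_eq_one (hδ1 hx) (h x)
    rw [hδ1 hx]
    linarith

theorem isWeakSupersolution_gradient_infDist (hC : IsClosed C) (hne : C.Nonempty)
    (hfin : volume Cᶜ ≠ ⊤) (hR : ∀ x : ℝᵈ, infDist x C ≤ R)
    (hdec : ∀ t > 0, DecreasesPerimeter {x | t ≤ infDist x C}) :
    IsWeakSupersolution Cᶜ 0 (gradient (infDist · C)) := by
  intro v h hv hv0
  rw [zero_mul]
  set I := ∫ x, inner ℝ (gradient (infDist · C) x) (h x) with hI
  set H := ∫ x, ‖h x‖ ^ 2 / 2 with hH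
  have hexp : ∀ ε > 0, 0 ≤ I + ε * H := fun ε hε ↦ by
    have h1 := integral_inner_add_integral_norm_sq_nonneg hC hne hfin hR hdec (hv.const_mul ε)
      (hv0.mono fun x hx ↦ mul_nonneg hε.le hx)
    simp only [inner_smul_right, norm_smul, mul_pow, mul_div_assoc, integral_const_mul,
      Real.norm_eq_abs, sq_abs, ← hI, ← hH] at h1
    refine nonneg_of_mul_nonneg_right ?_ hε
    linarith
  have hlim : Tendsto (fun ε : ℝ ↦ I + ε * H) (𝓝[>] 0) (𝓝 I) := by
    have h0 : ContinuousAt (fun ε : ℝ ↦ I + ε * H) 0 := by fun_prop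
    simpa [ContinuousAt] using h0.mono_left nhdsWithin_le_nhds
  exact ge_of_tendsto hlim (eventually_mem_of_tendsto_nhdsWithin tendsto_id |>.mono hexp)

end Superharmonic

/-! ### The torsion function -/

section Barrier

variable {C : Set (EuclideanSpace ℝ (Fin d))} {R : ℝ}

/-- The function `R δ - δ² / 2`, where `δ` is the distance to `C` and `R` a bound for `δ`; it
dominates the torsion function of `Cᶜ`. -/
def distBarrier (C : Set ℝᵈ) (R : ℝ) (x : ℝᵈ) : ℝ :=
  R * infDist x C - 1 / 2 * (infDist x C * infDist x C)

theorem distBarrier_le (C : Set ℝᵈ) (R : ℝ) (x : ℝᵈ) : distBarrier C R x ≤ R * infDist x C :=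
  sub_le_self _ (mul_nonneg one_half_pos.le (mul_self_nonneg _))

theorem MemSobolevLike.infDist_mul {Ω : Set ℝᵈ} {v : ℝᵈ → ℝ} {h : ℝᵈ → ℝᵈ}
    (hv : MemSobolevLike Ω v h) (hR : ∀ x : ℝᵈ, infDist x C ≤ R) :
    MemSobolevLike Ω (fun x ↦ infDist x C * v x)
      fun x ↦ infDist x C • h x + v x • gradient (infDist · C) x :=
  hv.lipschitz_mul (M := ⟨R, infDist_nonneg.trans (hR 0)⟩) (lipschitz_infDist_pt C)
    fun x ↦ (Real.norm_of_nonneg infDist_nonneg).trans_le (hR x)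

theorem memSobolevLike_distBarrier (hfin : volume Cᶜ ≠ ⊤) (hR : ∀ x : ℝᵈ, infDist x C ≤ R) :
    MemSobolevLike Cᶜ (distBarrier C R) fun x ↦ (R - infDist x C) • gradient (infDist · C) x := by
  have hδ := memSobolevLike_infDist hfin hR
  have hgrad : (fun x ↦ (R - infDist x C) • gradient (infDist · C) x) = fun x ↦
      R • gradient (infDist · C) x - (1 / 2 : ℝ) •
        (infDist x C • gradient (infDist · C) x + infDist x C • gradient (infDist · C) x) := by
    ext1 x
    module
  rw [hgrad]
  exact (hδ.const_mul R).sub ((hδ.infDist_mul hR).const_mul (1 / 2))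

theorem isWeakSupersolution_gradient_distBarrier (hC : IsClosed C) (hne : C.Nonempty)
    (hfin : volume Cᶜ ≠ ⊤) (hR : ∀ x : ℝᵈ, infDist x C ≤ R)
    (hdec : ∀ t > 0, DecreasesPerimeter {x | t ≤ infDist x C}) :
    IsWeakSupersolution Cᶜ 1 fun x ↦ (R - infDist x C) • gradient (infDist · C) x := by
  intro v h hv hv0
  have hsuper := isWeakSupersolution_gradient_infDist hC hne hfin hR hdec _ _
    ((hv.const_mul R).sub (hv.infDist_mul hR)) (by
      filter_upwards [hv0] with x hx
      rw [← sub_mul]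
      exact mul_nonneg (sub_nonneg.2 (hR x)) hx)
  have hb := integrable_inner_of_memLp_two (memSobolevLike_distBarrier hfin hR).memLp_grad
    hv.memLp_grad
  have hcongr : ∫ x, inner ℝ (gradient (infDist · C) x)
        (R • h x - (infDist x C • h x + v x • gradient (infDist · C) x)) =
      ∫ x, (inner ℝ ((R - infDist x C) • gradient (infDist · C) x) (h x) - v x) := by
    refine integral_congr_ae ?_
    filter_upwards [hv.ae_eq_zero, ae_norm_gradient_infDist hC hne] with x hv0 hδ1
    have hsq : v x * ‖gradient (infDist · C) x‖ ^ 2 = v x := by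
      by_cases hx : x ∈ C
      · rw [hv0 (not_not.2 hx), zero_mul]
      · rw [hδ1 hx, one_pow, mul_one]
    rw [← sub_sub, ← sub_smul, inner_sub_right, inner_smul_right, inner_smul_right,
      real_inner_smul_left, real_inner_self_eq_norm_sq, hsq]
  rw [zero_mul, hcongr, integral_sub hb (hv.integrable hfin)] at hsuper
  linarith

end Barrier

section Torsion

/-- The weak formulation of `-div g = 1` in `Ω`. A torsion function of `Ω` is an element of
`{v ∈ H¹(ℝ^d) : v = 0 a.e. on Ωᶜ}` whose weak gradient is a torsion field. -/
def IsTorsionField (Ω : Set ℝᵈ) (g : ℝᵈ → ℝᵈ) : Prop :=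
  ∀ (v : ℝᵈ → ℝ) (h : ℝᵈ → ℝᵈ), MemSobolevLike Ω v h → ∫ x, inner ℝ (g x) (h x) = ∫ x, v x

namespace IsTorsionField

variable {Ω : Set (EuclideanSpace ℝ (Fin d))} {w b : EuclideanSpace ℝ (Fin d) → ℝ}
  {g G : EuclideanSpace ℝ (Fin d) → EuclideanSpace ℝ (Fin d)}

theorem congr_set {Ω' : Set ℝᵈ} (hg : IsTorsionField Ω g) (hΩ : Ω =ᵐ[volume] Ω') :
    IsTorsionField Ω' g :=
  fun v h hv ↦ hg v h (hv.congr_set hΩ.symm)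

theorem ae_nonneg (hg : IsTorsionField Ω g) (hw : MemSobolevLike Ω w g) (hΩ : volume Ωᶜ ≠ 0) :
    ∀ᵐ x, 0 ≤ w x := by
  have hv := hw.neg.max_zero
  have hle : ∫ x, inner ℝ (-g x) (indicator {x | 0 < -w x} (fun x ↦ -g x) x) ≤ 0 := by
    simp only [inner_neg_left]
    rw [integral_neg, hg _ _ hv, neg_nonpos]
    exact integral_nonneg fun x ↦ le_max_right _ _
  filter_upwards [ae_nonpos_of_integral_inner_indicator_nonpos hΩ hv hle] with x hx
  exact neg_nonpos.1 hx

theorem ae_le (hg : IsTorsionField Ω g) (hw : MemSobolevLike Ω w g) (hΩ : volume Ωᶜ ≠ 0)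
    (hb : MemSobolevLike Ω b G) (hG : IsWeakSupersolution Ω 1 G) : ∀ᵐ x, w x ≤ b x := by
  have hv := (hw.sub hb).max_zero
  have hle : ∫ x, inner ℝ (g x - G x)
      (indicator {x | 0 < w x - b x} (fun x ↦ g x - G x) x) ≤ 0 := by
    simp only [inner_sub_left]
    rw [integral_sub (integrable_inner_of_memLp_two hw.memLp_grad hv.memLp_grad)
      (integrable_inner_of_memLp_two hb.memLp_grad hv.memLp_grad), hg _ _ hv, sub_nonpos]
    simpa only [one_mul] using hG _ _ hv (.of_forall fun x ↦ le_max_right _ _)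
  filter_upwards [ae_nonpos_of_integral_inner_indicator_nonpos hΩ hv hle] with x hx
  exact sub_nonpos.1 hx

theorem comp_add (hg : IsTorsionField Ω g) (a : ℝᵈ) :
    IsTorsionField ((· + a) ⁻¹' Ω) fun x ↦ g (x + a) := by
  intro v h hv
  have htest := hg _ _ ((hv.comp_add (-a)).mono fun x hx ↦ by simpa using hx)
  rw [integral_add_right_eq_self v, ← integral_add_right_eq_self _ a] at htest
  simpa only [add_neg_cancel_right] using htest

-- The positive part of `w(· + a) - w - k` is a test function for both `w(· + a)` and `w`.
theorem ae_comp_add_sub_le (hg : IsTorsionField Ω g) (hw : MemSobolevLike Ω w g)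
    (hΩ : volume Ωᶜ ≠ 0) {a : ℝᵈ} {k : ℝ} (hk : 0 ≤ k)
    (hwk : ∀ᵐ x, x ∉ Ω → w (x + a) ≤ k) : ∀ᵐ x, w (x + a) - w x ≤ k := by
  have hwa := hw.comp_add a
  have hv : MemSobolevLike (Ω ∩ (· + a) ⁻¹' Ω) (fun x ↦ max (w (x + a) - w x + -k) 0)
      (indicator {x | 0 < w (x + a) - w x + -k} fun x ↦ g (x + a) - g x) := by
    refine ((hwa.memSobolevLoc.sub hw.memSobolevLoc).add_const (-k)).memSobolevLike_max_zero
      (hwa.memLp.sub hw.memLp) (.of_forall fun x ↦ ?_) (hwa.memLp_grad.sub hw.memLp_grad) ?_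
    · exact (add_le_of_nonpos_right (neg_nonpos.2 hk)).trans (le_abs_self _)
    · filter_upwards [hg.ae_nonneg hw hΩ, hwk, hwa.ae_eq_zero] with x hx0 hxk hxa hx
      rcases not_and_or.1 hx with hx | hx
      · linarith [hxk hx]
      · linarith [hxa hx]
  have hvΩ := hv.mono inter_subset_left
  have hle : ∫ x, inner ℝ (g (x + a) - g x)
      (indicator {x | 0 < w (x + a) - w x + -k} (fun x ↦ g (x + a) - g x) x) ≤ 0 := by
    simp only [inner_sub_left]
    rw [integral_sub (integrable_inner_of_memLp_two hwa.memLp_grad hv.memLp_grad)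
      (integrable_inner_of_memLp_two hw.memLp_grad hv.memLp_grad), hg _ _ hvΩ,
      hg.comp_add a _ _ (hv.mono inter_subset_right), sub_self]
  filter_upwards [ae_nonpos_of_integral_inner_indicator_nonpos hΩ hvΩ hle] with x hx
  linarith

end IsTorsionField

section Representative

variable {E : Type*} [NormedAddCommGroup E] [InnerProductSpace ℝ E] [FiniteDimensional ℝ E]
  [MeasurableSpace E] [BorelSpace E] {w : E → ℝ}

theorem mollify_add_sub_mollify_le (n : ℕ) (hw : LocallyIntegrable w) {a : E} {c : ℝ}
    (h : ∀ᵐ x, w (x + a) - w x ≤ c) (x : E) : mollify n w (x + a) - mollify n w x ≤ c := by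
  have hshift : mollify n w (x + a) = ∫ t, mollifier E n (x - t) • w (t + a) := by
    rw [mollify_apply, ← integral_add_right_eq_self _ a]
    simp only [add_sub_add_right_eq_sub]
  have hx := integrable_mollifier_smul n hw x
  have hxa : Integrable fun t ↦ mollifier E n (x - t) • w (t + a) := by
    simpa only [add_sub_add_right_eq_sub] using
      (integrable_mollifier_smul n hw (x + a)).comp_add_right a
  rw [hshift, mollify_apply, ← integral_sub hxa hx]
  calc ∫ t, (mollifier E n (x - t) • w (t + a) - mollifier E n (x - t) • w t)
      ≤ ∫ t, mollifier E n (x - t) * c := by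
        refine integral_mono_ae (hxa.sub hx)
          (((integrable_mollifier n).comp_sub_left x).mul_const c) ?_
        filter_upwards [h] with t ht
        rw [← smul_sub, smul_eq_mul]
        exact mul_le_mul_of_nonneg_left ht (mollifier_nonneg n _)
    _ = c := by
        rw [integral_mul_const, integral_sub_left_eq_self, integral_mollifier, one_mul]

theorem exists_lipschitzWith_ae_eq_of_comp_add_sub_le (hw : LocallyIntegrable w) (K : ℝ≥0)
    (h : ∀ a, ∀ᵐ x, w (x + a) - w x ≤ K * ‖a‖) :
    ∃ W : E → ℝ, LipschitzWith K W ∧ ∀ᵐ x, W x = w x := by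
  have hmol : ∀ n x y, mollify n w x - mollify n w y ≤ K * dist x y := fun n x y ↦ by
    simpa only [add_sub_cancel, dist_eq_norm] using mollify_add_sub_mollify_le n hw (h (x - y)) y
  have hlip : LipschitzOnWith K w {x | Tendsto (fun n ↦ mollify n w x) atTop (𝓝 (w x))} :=
    .of_le_add_mul K fun x hx y hy ↦
      sub_le_iff_le_add'.1 (le_of_tendsto' (hx.sub hy) fun n ↦ hmol n x y)
  obtain ⟨W, hW, hWw⟩ := hlip.extend_real
  exact ⟨W, hW, (ae_tendsto_mollify hw).mono fun x hx ↦ (hWw hx).symm⟩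

end Representative

variable {C : Set (EuclideanSpace ℝ (Fin d))} {R : ℝ}
  {w : EuclideanSpace ℝ (Fin d) → ℝ} {g : EuclideanSpace ℝ (Fin d) → EuclideanSpace ℝ (Fin d)}

theorem IsTorsionField.ae_le_mul_infDist (hg : IsTorsionField Cᶜ g) (hw : MemSobolevLike Cᶜ w g)
    (hC : IsClosed C) (hC0 : volume C ≠ 0) (hfin : volume Cᶜ ≠ ⊤)
    (hR : ∀ x : ℝᵈ, infDist x C ≤ R)
    (hdec : ∀ t > 0, DecreasesPerimeter {x | t ≤ infDist x C}) :
    ∀ᵐ x, w x ≤ R * infDist x C := by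
  filter_upwards [hg.ae_le hw (by rwa [compl_compl]) (memSobolevLike_distBarrier hfin hR)
    (isWeakSupersolution_gradient_distBarrier hC (nonempty_of_measure_ne_zero hC0) hfin hR hdec)]
    with x hx
  exact hx.trans (distBarrier_le C R x)

theorem IsTorsionField.exists_lipschitzWith_ae_eq (hg : IsTorsionField Cᶜ g)
    (hw : MemSobolevLike Cᶜ w g) (hC0 : volume C ≠ 0) (hR : 0 ≤ R)
    (hwR : ∀ᵐ x, w x ≤ R * infDist x C) :
    ∃ W : ℝᵈ → ℝ, LipschitzWith R.toNNReal W ∧ (∀ᵐ x, W x = w x) ∧ ∀ x ∈ C, W x = 0 := by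
  have hΩ : volume Cᶜᶜ ≠ 0 := by rwa [compl_compl]
  have htrans : ∀ a, ∀ᵐ x, w (x + a) - w x ≤ R.toNNReal * ‖a‖ := fun a ↦ by
    rw [Real.coe_toNNReal R hR]
    refine hg.ae_comp_add_sub_le hw hΩ (mul_nonneg hR (norm_nonneg a)) ?_
    filter_upwards [(measurePreserving_add_right volume a).quasiMeasurePreserving.ae hwR]
      with x hx hxC
    refine hx.trans (mul_le_mul_of_nonneg_left ?_ hR)
    exact (infDist_le_dist_of_mem (not_not.1 hxC)).trans_eq (dist_self_add_left _ _)
  obtain ⟨W, hW, hWw⟩ := exists_lipschitzWith_ae_eq_of_comp_add_sub_le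
    hw.memSobolevLoc.locallyIntegrable _ htrans
  have hclamp : (fun x ↦ max 0 (min (W x) (R * infDist x C))) = W := by
    refine (Continuous.ae_eq_iff_eq volume (continuous_const.max
      (hW.continuous.min ((continuous_infDist_pt C).const_mul R))) hW.continuous).1 ?_
    filter_upwards [hg.ae_nonneg hw hΩ, hwR, hWw] with x hx0 hxR hx
    rw [hx, min_eq_left hxR, max_eq_right hx0]
  refine ⟨W, hW, hWw, fun x hx ↦ ?_⟩
  calc W x = max 0 (min (W x) (R * infDist x C)) := (congrFun hclamp x).symm
    _ = 0 := by rw [infDist_zero_of_mem hx, mul_zero, max_eq_left (min_le_right _ _)]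

end Torsion

section Support

variable {Ω : Set (EuclideanSpace ℝ (Fin d))}

theorem mem_support_restrict_compl_iff {x : ℝᵈ} :
    x ∈ (volume.restrict Ωᶜ).support ↔ ∀ r > 0, 0 < volume (ball x r \ Ω) := by
  rw [Metric.nhds_basis_ball.mem_measureSupport]
  simp only [Measure.restrict_apply measurableSet_ball, sdiff_eq]

theorem ae_eq_compl_support_restrict_compl (hΩ : IsOpen Ω) :
    Ω =ᵐ[volume] ((volume.restrict Ωᶜ).supportᶜ : Set ℝᵈ) := by
  refine (LE.le.eventuallyLE ?_).antisymm
    (ae_le_set.2 (volume_compl_support_restrict_compl_diff Ω))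
  refine Measure.subset_compl_support_of_isOpen hΩ ?_
  rw [Measure.restrict_apply hΩ.measurableSet, inter_compl_self, measure_empty]

theorem MemSobolevLike.eq_zero_of_volume_diff_pos [Subsingleton ℝᵈ] {u : ℝᵈ → ℝ} {g : ℝᵈ → ℝᵈ}
    (hu : MemSobolevLike Ω u g) {s : Set ℝᵈ} (hs : 0 < volume (s \ Ω)) (x : ℝᵈ) : u x = 0 := by
  obtain ⟨y, hy, hy0⟩ :=
    ((frequently_ae_mem_iff.2 hs.ne').and_eventually hu.ae_eq_zero).exists
  rw [Subsingleton.elim x y, hy0 hy.2]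

end Support

end

theorem proposition5 {d : ℕ} (Ω : Set (EuclideanSpace ℝ (Fin d))) (hΩ : IsOpen Ω)
    (hsup : IsPerimeterSupersolution Ω)
    (w : EuclideanSpace ℝ (Fin d) → ℝ) (hw : IsTorsionFunction Ω w) :
    ∃ (K : ℝ≥0) (W : EuclideanSpace ℝ (Fin d) → ℝ),
      LipschitzWith K W ∧
      (∀ᵐ x ∂volume, W x = w x) ∧
      (∀ x, (∀ r > 0, 0 < volume (Metric.ball x r \ Ω)) → W x = 0) := by
  obtain ⟨g, hw, hg : IsTorsionField Ω g⟩ := hw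
  rcases subsingleton_or_nontrivial (EuclideanSpace ℝ (Fin d)) with _ | _
  · exact ⟨0, w, fun x y ↦ by simp [Subsingleton.elim x y], .of_forall fun _ ↦ rfl,
      fun x hx ↦ hw.eq_zero_of_volume_diff_pos (hx 1 one_pos) x⟩
  set C : Set (EuclideanSpace ℝ (Fin d)) := (volume.restrict Ωᶜ).support
  have hΩC : Ω =ᵐ[volume] Cᶜ := ae_eq_compl_support_restrict_compl hΩ
  have hfin : volume Cᶜ ≠ ⊤ := measure_congr hΩC ▸ hsup.volume_lt_top.ne
  have hC0 : volume C ≠ 0 := measure_ne_zero_of_measure_compl_ne_top hfin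
  have hdec : ∀ t > 0, DecreasesPerimeter {x | t ≤ infDist x C} := fun t ht ↦
    hsup.decreasesPerimeter.setOf_le_infDist_support hΩ.measurableSet
      hsup.volume_lt_top.ne (nonempty_of_measure_ne_zero hC0) ht
  obtain ⟨R, hR⟩ := exists_forall_infDist_le hfin
  have hwC : MemSobolevLike Cᶜ w g := hw.congr_set hΩC
  have hgC : IsTorsionField Cᶜ g := hg.congr_set hΩC
  have hwR : ∀ᵐ x, w x ≤ R * infDist x C :=
    hgC.ae_le_mul_infDist hwC Measure.isClosed_support hC0 hfin hR hdec
  obtain ⟨W, hW, hWw, hW0⟩ :=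
    hgC.exists_lipschitzWith_ae_eq hwC hC0 (infDist_nonneg.trans (hR 0)) hwR
  exact ⟨_, W, hW, hWw, fun x hx ↦ hW0 x (mem_support_restrict_compl_iff.2 hx)⟩
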